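/- Let $n \geq 2$. For $i \in \{1,\dots,2n\}$ put $i^* = 2n+1-i$; let $S^*_{2n}$ be the group of permutations $\sigma$ of $\{1,\dots,2n\}$ with $\sigma(i^*) = \sigma(i)^*$ for all $i$, and let $S^\circ_{2n} \subset S^*_{2n}$ be the subgroup of those that are even permutations of $\{1,\dots,2n\}$. The group $S^*_{2n}$ acts on $\mathbb{Z}^n$ and $\mathbb{R}^n$ by permuting the entries of $(x_1,\dots,x_n,-x_n,\dots,-x_1)$. Let $\widetilde W_{2n} = \mathbb{Z}^n \rtimes S^*_{2n}$ be the Iwahori-Weyl group of the split orthogonal group $O_{2n}$; write $t_\nu$ for $\nu \in \mathbb{Z}^n$ regarded as an element of $\widetilde W_{2n}$. It acts on $\mathbb{R}^n$ by $(t_\nu\sigma)x = \sigma x + \nu$. Let $W_{\mathrm{a}} = Q^\vee \rtimes S^\circ_{2n}$ be the affine Weyl group, where $Q^\vee = \{x \in \mathbb{Z}^n \mid \sum_i x_i \text{ is even}\}$. Let $A \subset \mathbb{R}^n$ be the base alcove for the roots $\pm x_i \pm x_j$ $(i<j)$ of $SO_{2n}$, i.e. the alcove whose closure contains the origin and on which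 the simple roots $x_i - x_{i+1}$ $(1 \leq i \leq n-1)$ and $x_{n-1}+x_n$ are positive. Let $W_{\mathrm{a}}$ carry the Bruhat order of the Coxeter group generated by the reflections across the walls of $A$, and let $\Omega$ be the stabilizer of $A$ in $\widetilde W_{2n}$. The Bruhat order on $\widetilde W_{2n} = W_{\mathrm{a}} \rtimes \Omega$ is defined by: $x\omega \leq x'\omega'$ (with $x, x' \in W_{\mathrm{a}}$ and $\omega, \omega' \in \Omega$) if and only if $\omega = \omega'$ and $x \leq x'$ in $W_{\mathrm{a}}$. Let $\mu = (1,0,\dots,0) \in \mathbb{Z}^n$. An element $w \in \widetilde W_{2n}$ is called $\mu$-permissible if $w \equiv t_\mu \bmod W_{\mathrm{a}}$ and $wa - a$ lies in the convex hull of the orbit $S^\circ_{2n}\mu$ in $\mathbb{R}^n$ for every $a \in A$. If $w = t_{v_0}\sigma \in \widetilde W_{2n}$ (with $v_0 \in \mathbb{Z}^n$ and $\sigma \in S^*_{2n}$) is $\mu$-permissible, then $w \leq t_{v_0}$ in the Bruhat order on $\widetilde W_{2n}$. -/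

import Mathlib

open scoped BigOperators

namespace OrthWeyl

/-! ### The Bruhat order of a group with a distinguished generating set -/

section Bruhat

variable {G : Type*} [Group G]

/-- The length of `x` with respect to `S`: the least length of a word in elements of `S`
whose product is `x`. (It is used for sets `S` of involutions that generate `G`.) -/
noncomputable def wordLength (S : Set G) (x : G) : ℕ :=
  sInf {k : ℕ | ∃ l : List G, (∀ s ∈ l, s ∈ S) ∧ l.prod = x ∧ l.length = k}

/-- The reflections of `(G, S)`: all conjugates of elements of `S`. -/
def reflections (S : Set G) : Set G :=
  {t : G | ∃ g : G, ∃ s ∈ S, t = g * s * g⁻¹}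

/-- The Bruhat order of `(G, S)`: the reflexive and transitive closure of the relation
`x < t * x`, for `t` a reflection with `ℓ(x) < ℓ(t * x)`. -/
def CoxeterBruhatLE (S : Set G) : G → G → Prop :=
  Relation.ReflTransGen fun x y =>
    ∃ t ∈ reflections S, y = t * x ∧ wordLength S x < wordLength S y

end Bruhat

/-! ### The finite Weyl groups and their action on `ℤⁿ` and `ℝⁿ` -/

/-- `S*_{2n}`: the permutations `σ` of `2n` letters with `σ(i*) = σ(i)*`, where
`i* = 2n + 1 - i`. The letters are numbered from `0` here, so that `i*` is `Fin.rev i`. -/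
def starPerm (n : ℕ) : Subgroup (Equiv.Perm (Fin (2 * n))) where
  carrier := {σ | ∀ i, σ (Fin.rev i) = Fin.rev (σ i)}
  one_mem' := by intro i; rfl
  mul_mem' := by
    intro σ τ hσ hτ i
    have h1 := hτ i
    have h2 := hσ (τ i)
    simp only [Equiv.Perm.mul_apply]
    rw [h1, h2]
  inv_mem' := by
    intro σ hσ i
    have h := hσ (σ⁻¹ i)
    rw [Equiv.Perm.inv_eq_iff_eq, h]
    simp

/-- `(x₁, …, xₙ) ↦ (x₁, …, xₙ, -xₙ, …, -x₁)`. -/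
def embed {R : Type*} [Neg R] {n : ℕ} (x : Fin n → R) : Fin (2 * n) → R := fun k =>
  if h : (k : ℕ) < n then x ⟨k, h⟩ else -x ⟨2 * n - 1 - k, by omega⟩

/-- The inclusion of the first `n` letters into all `2n` letters. -/
def low {n : ℕ} (i : Fin n) : Fin (2 * n) := ⟨i, by omega⟩

/-- The action of `S*_{2n}` on `Rⁿ`, obtained from the permutation of the entries of vectors
in `R²ⁿ` (the basis vector `e_i` goes to `e_{σ(i)}`) by restriction along `embed`. -/
def permAct {R : Type*} [Neg R] {n : ℕ} (σ : starPerm n) (x : Fin n → R) : Fin n → R :=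
  fun i => embed x ((σ : Equiv.Perm (Fin (2 * n)))⁻¹ (low i))

section PermAct

variable {R : Type*} [AddCommGroup R] {n : ℕ}

theorem embed_low (x : Fin n → R) (i : Fin n) : embed x (low i) = x i := by
  simp [embed, low]

theorem embed_rev (x : Fin n → R) (k : Fin (2 * n)) : embed x (Fin.rev k) = -embed x k := by
  unfold embed
  by_cases h : (k : ℕ) < n
  · have h' : ¬ ((Fin.rev k : Fin (2 * n)) : ℕ) < n := by rw [Fin.val_rev]; omega
    rw [dif_neg h', dif_pos h]
    congr 2
    apply Fin.ext
    simp only [Fin.val_rev]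
    omega
  · have h' : ((Fin.rev k : Fin (2 * n)) : ℕ) < n := by rw [Fin.val_rev]; omega
    rw [dif_pos h', dif_neg h, neg_neg]
    congr 1
    apply Fin.ext
    simp only [Fin.val_rev]
    omega

/-- `embed` carries `permAct` to the permutation of entries. -/
theorem embed_permAct (σ : starPerm n) (x : Fin n → R) (k : Fin (2 * n)) :
    embed (permAct σ x) k = embed x ((σ : Equiv.Perm (Fin (2 * n)))⁻¹ k) := by
  by_cases h : (k : ℕ) < n
  · have hk : k = low ⟨k, h⟩ := rfl
    rw [hk, embed_low]
    rfl
  · have h' : (Fin.rev k : Fin (2 * n)).val < n := by rw [Fin.val_rev]; omega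
    have hk : k = Fin.rev (low ⟨(Fin.rev k : Fin (2 * n)).val, h'⟩) := by
      change k = Fin.rev (Fin.rev k)
      rw [Fin.rev_rev]
    have hs := (starPerm n).inv_mem σ.2 (low ⟨(Fin.rev k : Fin (2 * n)).val, h'⟩)
    rw [hk, embed_rev, embed_low, hs, embed_rev]
    rfl

theorem permAct_one (x : Fin n → R) : permAct (1 : starPerm n) x = x := by
  funext i
  simp [permAct, embed_low]

theorem permAct_mul (σ τ : starPerm n) (x : Fin n → R) :
    permAct (σ * τ) x = permAct σ (permAct τ x) := by
  funext i
  change _ = embed (permAct τ x) _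
  rw [embed_permAct]
  simp [permAct]

theorem embed_add (x y : Fin n → R) (k : Fin (2 * n)) :
    embed (x + y) k = embed x k + embed y k := by
  unfold embed
  split_ifs
  · rfl
  · simp only [Pi.add_apply, neg_add]

theorem permAct_add (σ : starPerm n) (x y : Fin n → R) :
    permAct σ (x + y) = permAct σ x + permAct σ y := by
  funext i
  exact embed_add x y _

end PermAct

/-- The action of `S*_{2n}` on the (multiplicatively written) group `ℤⁿ` by automorphisms. -/
def latticeAct (n : ℕ) : starPerm n →* MulAut (Multiplicative (Fin n → ℤ)) where
  toFun σ := AddEquiv.toMultiplicative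
    { toFun := permAct σ
      invFun := permAct σ⁻¹
      left_inv := fun x => by rw [← permAct_mul, inv_mul_cancel, permAct_one]
      right_inv := fun x => by rw [← permAct_mul, mul_inv_cancel, permAct_one]
      map_add' := permAct_add σ }
  map_one' := by
    apply MulEquiv.ext
    intro x
    exact congrArg Multiplicative.ofAdd (permAct_one x.toAdd)
  map_mul' σ τ := by
    apply MulEquiv.ext
    intro x
    exact congrArg Multiplicative.ofAdd (permAct_mul σ τ x.toAdd)

/-! ### The Iwahori-Weyl group of `O_{2n}` -/

/-- The Iwahori-Weyl group `ℤⁿ ⋊ S*_{2n}` of `O_{2n}`. The element with components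
`left = ν` and `right = σ` is `t_ν σ`. -/
abbrev IwahoriWeyl (n : ℕ) : Type :=
  Multiplicative (Fin n → ℤ) ⋊[latticeAct n] starPerm n

/-- The translation element `t_ν`. -/
def translation {n : ℕ} (ν : Fin n → ℤ) : IwahoriWeyl n :=
  SemidirectProduct.inl (Multiplicative.ofAdd ν)

/-- The vector `ν` such that `w = t_ν σ` with `σ` in `S*_{2n}`. -/
def transVec {n : ℕ} (w : IwahoriWeyl n) : Fin n → ℤ := w.left.toAdd

/-- The linear part `σ` of `w = t_ν σ`. -/
def linPart {n : ℕ} (w : IwahoriWeyl n) : starPerm n := w.right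

/-- The affine linear action of `w = t_ν σ` on `ℝⁿ`: `x ↦ σ x + ν`. -/
def act {n : ℕ} (w : IwahoriWeyl n) (x : Fin n → ℝ) : Fin n → ℝ :=
  permAct (linPart w) x + fun i => (transVec w i : ℝ)

/-- The elements `σ` of `S*_{2n}` that are even as permutations of `2n` letters: `S°_{2n}`. -/
def IsEven {n : ℕ} (σ : starPerm n) : Prop :=
  Equiv.Perm.sign (σ : Equiv.Perm (Fin (2 * n))) = 1

theorem sum_abs_embed {n : ℕ} (x : Fin n → ℤ) :
    ∑ k, |embed x k| = 2 * ∑ i, |x i| := by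
  have hlow : ∑ k ∈ Finset.univ.filter (fun k : Fin (2 * n) => (k : ℕ) < n), |embed x k|
      = ∑ i, |x i| := by
    refine (Finset.sum_bij (fun i _ => low i) ?_ ?_ ?_ ?_).symm
    · intro i _
      simp [low]
    · intro i _ j _ h
      exact Fin.ext (Fin.mk.inj h)
    · intro k hk
      exact ⟨⟨k, (Finset.mem_filter.1 hk).2⟩, Finset.mem_univ _, rfl⟩
    · intro i _
      rw [embed_low]
  have hhigh : ∑ k ∈ Finset.univ.filter (fun k : Fin (2 * n) => ¬ (k : ℕ) < n), |embed x k|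
      = ∑ k ∈ Finset.univ.filter (fun k : Fin (2 * n) => (k : ℕ) < n), |embed x k| := by
    refine Finset.sum_bij (fun k _ => Fin.rev k) ?_ ?_ ?_ ?_
    · intro k hk
      have := (Finset.mem_filter.1 hk).2
      rw [Finset.mem_filter]
      refine ⟨Finset.mem_univ _, ?_⟩
      rw [Fin.val_rev]
      omega
    · intro i _ j _ h
      exact Fin.rev_injective h
    · intro k hk
      have := (Finset.mem_filter.1 hk).2
      refine ⟨Fin.rev k, ?_, Fin.rev_rev k⟩
      rw [Finset.mem_filter]
      refine ⟨Finset.mem_univ _, ?_⟩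
      rw [Fin.val_rev]
      omega
    · intro k _
      rw [embed_rev, abs_neg]
  rw [← Finset.sum_filter_add_sum_filter_not Finset.univ (fun k : Fin (2 * n) => (k : ℕ) < n),
    hhigh, hlow, two_mul]

theorem even_sum_iff_abs {n : ℕ} (x : Fin n → ℤ) : Even (∑ i, x i) ↔ Even (∑ i, |x i|) := by
  have h : Even (∑ i, (x i - |x i|)) := by
    refine Finset.even_sum _ fun i _ => ?_
    rcases abs_choice (x i) with h | h <;> rw [h] <;> simp
  rw [Finset.sum_sub_distrib, Int.even_sub] at h
  exact h

/-- The action of `S*_{2n}` changes the sum of the entries by an even number. -/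
theorem even_sum_permAct {n : ℕ} (σ : starPerm n) (x : Fin n → ℤ) :
    Even (∑ i, permAct σ x i) ↔ Even (∑ i, x i) := by
  have h : ∑ k, |embed (permAct σ x) k| = ∑ k, |embed x k| := by
    simp only [embed_permAct]
    exact Equiv.sum_comp (σ : Equiv.Perm (Fin (2 * n)))⁻¹ fun k => |embed x k|
  rw [sum_abs_embed, sum_abs_embed] at h
  rw [even_sum_iff_abs, even_sum_iff_abs x, mul_left_cancel₀ two_ne_zero h]

/-- The affine Weyl group `Q^∨ ⋊ S°_{2n}`, where `Q^∨` is the coroot lattice of all vectors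
in `ℤⁿ` with even sum of entries. -/
def affineWeyl (n : ℕ) : Subgroup (IwahoriWeyl n) where
  carrier := {w | Even (∑ i, transVec w i) ∧ IsEven (linPart w)}
  one_mem' := by
    refine ⟨?_, ?_⟩
    · simp [transVec]
    · simp [IsEven, linPart]
  mul_mem' := by
    rintro a b ⟨ha, ha'⟩ ⟨hb, hb'⟩
    refine ⟨?_, ?_⟩
    · have h : transVec (a * b) = transVec a + permAct (linPart a) (transVec b) := rfl
      rw [h]
      simp only [Pi.add_apply, Finset.sum_add_distrib]
      exact ha.add ((even_sum_permAct _ _).2 hb)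
    · simp only [IsEven, linPart] at *
      simp [ha', hb']
  inv_mem' := by
    rintro a ⟨ha, ha'⟩
    refine ⟨?_, ?_⟩
    · have h : transVec a⁻¹ = permAct (linPart a)⁻¹ (-transVec a) := rfl
      rw [h, even_sum_permAct]
      simpa using ha
    · simp only [IsEven, linPart] at *
      simp [ha']

/-! ### Roots, base alcove, simple reflections -/

/-- The roots `x ↦ ±x_i ± x_j`, `i < j`, of `SO_{2n}`, as vectors of coefficients. The coroot of
such a root is the vector `±e_i ± e_j` with the same coefficients. -/
def roots (n : ℕ) : Set (Fin n → ℤ) :=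
  {α | ∃ i j : Fin n, i < j ∧ ∃ ε δ : ℤˣ,
    α = Pi.single i (ε : ℤ) + Pi.single j (δ : ℤ)}

/-- The simple roots `x_i - x_{i+1}`, `1 ≤ i ≤ n - 1`, and `x_{n-1} + x_n`. -/
def simpleRoots (n : ℕ) : Set (Fin n → ℤ) :=
  {α | ∃ i j : Fin n, (i : ℕ) + 1 = j ∧
    (α = Pi.single i 1 - Pi.single j 1 ∨
      (j : ℕ) + 1 = n ∧ α = Pi.single i 1 + Pi.single j 1)}

/-- The value of the linear form with coefficients `α` at `x`. -/
def pairing {n : ℕ} (α : Fin n → ℤ) (x : Fin n → ℝ) : ℝ := ∑ i, (α i : ℝ) * x i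

/-- The base alcove: the alcove that lies in the positive Weyl chamber and has the origin in its
closure. -/
def baseAlcove (n : ℕ) : Set (Fin n → ℝ) :=
  {x | (∀ α ∈ simpleRoots n, 0 < pairing α x) ∧ ∀ α ∈ roots n, pairing α x < 1}

/-- The hyperplane on which the affine root `α - k` vanishes. -/
def hyperplane {n : ℕ} (α : Fin n → ℤ) (k : ℤ) : Set (Fin n → ℝ) :=
  {x | pairing α x = k}

/-- A hyperplane is a wall of the base alcove `A` if it is spanned by its intersection with the
closure of `A`. -/
def IsWall {n : ℕ} (H : Set (Fin n → ℝ)) : Prop :=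
  (affineSpan ℝ (closure (baseAlcove n) ∩ H) : Set (Fin n → ℝ)) = H

/-- The simple reflections: the elements of the affine Weyl group that act on `ℝⁿ` as the
reflection across a wall of the base alcove. -/
def simpleReflections (n : ℕ) : Set (affineWeyl n) :=
  {s | ∃ α ∈ roots n, ∃ k : ℤ, IsWall (hyperplane α k) ∧
    ∀ x, act (s : IwahoriWeyl n) x = x - (pairing α x - k) • fun i => (α i : ℝ)}

/-- The stabilizer `Ω` of the base alcove in the Iwahori-Weyl group. -/
def Omega (n : ℕ) : Set (IwahoriWeyl n) :=
  {ω | act ω '' baseAlcove n = baseAlcove n}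

/-- The Bruhat order of the Iwahori-Weyl group: `x ω ≤ x' ω'`, for `x`, `x'` in the affine Weyl
group and `ω`, `ω'` in `Ω`, if `ω = ω'` and `x ≤ x'` in the affine Weyl group. -/
def BruhatLE {n : ℕ} (w w' : IwahoriWeyl n) : Prop :=
  ∃ x x' : affineWeyl n, ∃ ω ∈ Omega n,
    w = x * ω ∧ w' = x' * ω ∧ CoxeterBruhatLE (simpleReflections n) x x'

/-! ### Permissibility -/

/-- The convex hull in `ℝⁿ` of the orbit of the cocharacter `μ` under the Weyl group `S°_{2n}`. -/
def convOrbit {n : ℕ} (μ : Fin n → ℤ) : Set (Fin n → ℝ) :=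
  convexHull ℝ {v | ∃ σ : starPerm n, IsEven σ ∧ v = fun i => ((permAct σ μ i : ℤ) : ℝ)}

/-- `w` is `μ`-permissible: `w ≡ t_μ` modulo the affine Weyl group, and `w a - a` lies in the convex
hull of the Weyl group orbit of `μ` for all `a` in the base alcove. -/
def Permissible {n : ℕ} (μ : Fin n → ℤ) (w : IwahoriWeyl n) : Prop :=
  (translation μ)⁻¹ * w ∈ affineWeyl n ∧ ∀ a ∈ baseAlcove n, act w a - a ∈ convOrbit μ

/-- The cocharacter `(1, 0, …, 0)`. -/
def mu (n : ℕ) : Fin n → ℤ := fun i => if (i : ℕ) = 0 then 1 else 0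

end OrthWeyl

namespace OrthWeyl

variable {n : ℕ}

/-! ### Letters and their coordinate vectors -/

/-! Write `h = 2n - 2`, `f_k` for the vector with `k` ones followed by zeros, `τ = σ⁻¹`, and `e_{i*}
= -e_i`, so that every root is a difference `e_j - e_l` of letters.

The convex hull of the orbit of `μ` lies in the ℓ¹ unit ball, and by continuity the permissibility
bound extends to the closure of the alcove. At the origin, together with parity, it gives `v₀ = e_j`
for a single letter `j` (`Permissible.exists_letterVec`). At the points `f_k / 2` it gives the
inequalities `VertexBound`: the discrepancy between `σ f_k` and `f_k` away from `j` and `j*` is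
controlled by the drop of the entry at `j`.

Let `t` be the reflection in `e_j - e_l - 1` and `s` its linear part. Then `t · t_{e_j} σ = t_{e_j}
s σ`, so the translation part does not change, and `t` raises the length when `ρ(τ j) < ρ(τ l)`. The
combinatorial heart is `exists_step`: if `σ ≠ 1` is even and satisfies all the bounds, some `l`
gives a step that goes up and preserves all the bounds. The natural choice is `l = τ j`. When it
fails, `σ` flips the sign of the entry of `f_{p+1}` at `j` and changes nothing else, where `p = (τ
j)*`; evenness of `σ` then provides a letter `r` beyond `p` for which `l = r*` works. There are only
finitely many `σ`, so the climb ends, and it can end only at `σ = 1`, that is, at `t_{v₀}`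
(`coxeterBruhatLE_of_vertexBound`).

That such a step raises the length is the strong exchange condition (`strong_exchange_word`), proved
geometrically by following the point `ρ / h` of the alcove. Multiplied by `h`, all affine root
values at its images are nonzero integers. The affine roots with value `±1` at `ρ` define walls
(`isWall_of_rho_sub`), and their reflections generate the affine Weyl group (`exists_word`). Finally
`w` and `t_{v₀}` have the same component in `Ω`, given by `exists_odd_stabilizer`. -/

theorem low_injective : Function.Injective (low : Fin n → Fin (2 * n)) := fun _ _ h =>
  Fin.ext (Fin.mk.inj h)

theorem low_ne_rev_low (i j : Fin n) : low i ≠ Fin.rev (low j) := by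
  intro h
  have := congrArg Fin.val h
  rw [Fin.val_rev] at this
  simp only [low] at this
  omega

theorem letter_cases (l : Fin (2 * n)) : (∃ i : Fin n, l = low i) ∨ ∃ i : Fin n, l = Fin.rev (low i) := by
  by_cases h : (l : ℕ) < n
  · exact Or.inl ⟨⟨l, h⟩, rfl⟩
  · have h' : ((Fin.rev l : Fin (2 * n)) : ℕ) < n := by rw [Fin.val_rev]; omega
    exact Or.inr ⟨⟨_, h'⟩, (Fin.rev_rev l).symm⟩

theorem rev_ne_self (l : Fin (2 * n)) : Fin.rev l ≠ l := by
  intro h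
  have := congrArg Fin.val h
  rw [Fin.val_rev] at this
  omega

theorem embed_ext {R : Type*} [Neg R] {x y : Fin n → R} (h : ∀ l, embed x l = embed y l) : x = y := by
  funext i
  have := h (low i)
  simpa [embed, low] using this

theorem embed_sub {R : Type*} [AddCommGroup R] (x y : Fin n → R) (k : Fin (2 * n)) :
    embed (x - y) k = embed x k - embed y k := by
  unfold embed
  split_ifs
  · rfl
  · simp only [Pi.sub_apply]; abel

theorem embed_neg {R : Type*} [AddCommGroup R] (x : Fin n → R) (k : Fin (2 * n)) :
    embed (-x) k = -embed x k := by
  unfold embed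
  split_ifs
  · rfl
  · rfl

theorem embed_smul {R : Type*} [CommRing R] (c : R) (x : Fin n → R) (k : Fin (2 * n)) :
    embed (c • x) k = c * embed x k := by
  unfold embed
  split_ifs
  · rfl
  · simp

theorem embed_intCast {R : Type*} [CommRing R] (x : Fin n → ℤ) (k : Fin (2 * n)) :
    embed (fun i => (x i : R)) k = (embed x k : ℤ) := by
  unfold embed
  split_ifs
  · rfl
  · simp

/-- The vector `e_i` for the letter `i`, and `-e_i` for the letter `i*`. -/
def letterVec (l : Fin (2 * n)) : Fin n → ℤ := fun i =>
  (if low i = l then 1 else 0) - (if Fin.rev (low i) = l then 1 else 0)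

theorem embed_letterVec (l m : Fin (2 * n)) :
    embed (letterVec l) m = (if m = l then 1 else 0) - (if Fin.rev m = l then 1 else 0) := by
  rcases letter_cases m with ⟨i, rfl⟩ | ⟨i, rfl⟩
  · rw [embed_low]; rfl
  · rw [embed_rev, embed_low, Fin.rev_rev, letterVec]
    abel

theorem letterVec_low (i : Fin n) : letterVec (low i) = Pi.single i 1 := by
  funext k
  simp only [letterVec, low_injective.eq_iff, (low_ne_rev_low i k).symm, if_false, sub_zero,
    Pi.single_apply]

theorem letterVec_rev (l : Fin (2 * n)) : letterVec (Fin.rev l) = -letterVec l := by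
  funext k
  have h : ∀ m : Fin (2 * n), (m = Fin.rev l) = (Fin.rev m = l) := fun m => by
    rw [eq_iff_iff]
    constructor
    · rintro rfl; exact Fin.rev_rev l
    · rintro rfl; exact (Fin.rev_rev m).symm
  simp only [letterVec, h, Fin.rev_rev, Pi.neg_apply, neg_sub]

theorem sum_letterVec_mul {R : Type*} [CommRing R] (l : Fin (2 * n)) (x : Fin n → R) :
    ∑ i, ((letterVec l i : ℤ) : R) * x i = embed x l := by
  rcases letter_cases l with ⟨i, rfl⟩ | ⟨i, rfl⟩
  · rw [letterVec_low, embed_low]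
    simp [Pi.single_apply]
  · rw [letterVec_rev, letterVec_low, embed_rev, embed_low]
    simp [Pi.single_apply]

theorem pairing_letterVec_sub (j l : Fin (2 * n)) (x : Fin n → ℝ) :
    pairing (letterVec j - letterVec l) x = embed x j - embed x l := by
  simp only [pairing, Pi.sub_apply, Int.cast_sub, sub_mul, Finset.sum_sub_distrib,
    sum_letterVec_mul]

theorem odd_sum_letterVec (l : Fin (2 * n)) : Odd (∑ i, letterVec l i) := by
  rcases letter_cases l with ⟨i, rfl⟩ | ⟨i, rfl⟩
  · rw [letterVec_low]; simp
  · rw [letterVec_rev, letterVec_low]; simp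

theorem single_units_eq_letterVec (i : Fin n) (ε : ℤˣ) :
    (Pi.single i (ε : ℤ) : Fin n → ℤ) = letterVec (low i) ∨
      (Pi.single i (ε : ℤ) : Fin n → ℤ) = letterVec (Fin.rev (low i)) := by
  rcases Int.units_eq_one_or ε with rfl | rfl
  · left; rw [letterVec_low]; rfl
  · right; rw [letterVec_rev, letterVec_low, ← Pi.single_neg]; rfl

theorem letterVec_eq_single (l : Fin (2 * n)) : ∃ (i : Fin n) (ε : ℤˣ),
    letterVec l = Pi.single i (ε : ℤ) ∧ (l = low i ∨ l = Fin.rev (low i)) := by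
  rcases letter_cases l with ⟨i, rfl⟩ | ⟨i, rfl⟩
  · exact ⟨i, 1, by rw [letterVec_low]; rfl, Or.inl rfl⟩
  · exact ⟨i, -1, by rw [letterVec_rev, letterVec_low, ← Pi.single_neg]; rfl, Or.inr rfl⟩

/-- Absorbing signs into letters gives all roots the type A shape `e_j - e_l`. The four sign
patterns need no separate treatment afterwards; only `l = j` and `l = j*` are excluded. -/
theorem mem_roots_iff {α : Fin n → ℤ} : α ∈ roots n ↔
    ∃ j l : Fin (2 * n), j ≠ l ∧ j ≠ Fin.rev l ∧ α = letterVec j - letterVec l := by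
  constructor
  · rintro ⟨i, j, hij, ε, δ, rfl⟩
    have hne : low i ≠ low j := fun h => hij.ne (low_injective h)
    have hne' := low_ne_rev_low i j
    rcases single_units_eq_letterVec i ε with h1 | h1 <;>
      rcases single_units_eq_letterVec j δ with h2 | h2 <;> rw [h1, h2]
    · exact ⟨_, Fin.rev (low j), hne', by rwa [Fin.rev_rev],
        by rw [letterVec_rev, sub_neg_eq_add]⟩
    · exact ⟨_, low j, hne, hne', by rw [letterVec_rev, sub_eq_add_neg]⟩
    · exact ⟨_, Fin.rev (low j), fun h => hne (Fin.rev_injective h),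
        by rw [Fin.rev_rev]; exact (low_ne_rev_low j i).symm,
        by rw [letterVec_rev (low j), sub_neg_eq_add]⟩
    · exact ⟨_, low j, (low_ne_rev_low j i).symm, fun h => hne (Fin.rev_injective h),
        by rw [letterVec_rev (low j), sub_eq_add_neg]⟩
  · rintro ⟨j, l, h1, h2, rfl⟩
    obtain ⟨i, ε, hi, hi'⟩ := letterVec_eq_single j
    obtain ⟨k, δ, hk, hk'⟩ := letterVec_eq_single l
    have hik : i ≠ k := by
      rintro rfl
      rcases hi' with rfl | rfl <;> rcases hk' with rfl | rfl
      · exact h1 rfl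
      · exact h2 (Fin.rev_rev _).symm
      · exact h2 rfl
      · exact h1 rfl
    have hneg : -(Pi.single k (δ : ℤ) : Fin n → ℤ) = Pi.single k ((-δ : ℤˣ) : ℤ) := by
      rw [← Pi.single_neg]; rfl
    rw [hi, hk, sub_eq_add_neg, hneg]
    rcases lt_or_gt_of_ne hik with h | h
    · exact ⟨i, k, h, ε, -δ, rfl⟩
    · exact ⟨k, i, h, -δ, ε, add_comm _ _⟩

/-! ### Reflections -/

theorem swap_commute_swap_rev (j l : Fin (2 * n)) :
    Commute (Equiv.swap j l) (Equiv.swap (Fin.rev j) (Fin.rev l)) := by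
  by_cases h1 : j = l
  · simp [h1]
  by_cases h2 : j = Fin.rev l
  · subst h2
    rw [Fin.rev_rev, Equiv.swap_comm]
  symm
  change _ = _
  rw [Equiv.mul_swap_eq_swap_mul, Equiv.swap_apply_of_ne_of_ne (rev_ne_self j).symm h2,
    Equiv.swap_apply_of_ne_of_ne _ (rev_ne_self l).symm]
  rintro rfl
  exact h2 (Fin.rev_rev _).symm

/-- The reflection in the root `e_j - e_l`, for letters `j` and `l`. -/
def weylRefl (j l : Fin (2 * n)) : starPerm n :=
  ⟨Equiv.swap j l * Equiv.swap (Fin.rev j) (Fin.rev l), by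
    have h : (Fin.revPerm : Equiv.Perm (Fin (2 * n))) *
        (Equiv.swap j l * Equiv.swap (Fin.rev j) (Fin.rev l)) =
        (Equiv.swap j l * Equiv.swap (Fin.rev j) (Fin.rev l)) * Fin.revPerm := by
      rw [← mul_assoc, Equiv.mul_swap_eq_swap_mul Fin.revPerm, mul_assoc _ Fin.revPerm,
        Equiv.mul_swap_eq_swap_mul Fin.revPerm, ← mul_assoc]
      simp only [Fin.revPerm_apply, Fin.rev_rev]
      rw [(swap_commute_swap_rev j l).eq]
    intro i
    exact (Equiv.congr_fun h i).symm⟩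

theorem starPerm_rev (σ : starPerm n) (i : Fin (2 * n)) :
    (σ : Equiv.Perm (Fin (2 * n))) (Fin.rev i) = Fin.rev ((σ : Equiv.Perm (Fin (2 * n))) i) :=
  σ.2 i

theorem starPerm_inv_rev (σ : starPerm n) (i : Fin (2 * n)) :
    (σ : Equiv.Perm (Fin (2 * n)))⁻¹ (Fin.rev i) =
      Fin.rev ((σ : Equiv.Perm (Fin (2 * n)))⁻¹ i) :=
  (starPerm n).inv_mem σ.2 i

theorem weylRefl_apply {j l : Fin (2 * n)} (h1 : j ≠ l) (h2 : j ≠ Fin.rev l) (m : Fin (2 * n)) :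
    (weylRefl j l : Equiv.Perm (Fin (2 * n))) m =
      if m = j then l else if m = l then j else if m = Fin.rev j then Fin.rev l else
        if m = Fin.rev l then Fin.rev j else m := by
  have h3 : Fin.rev j ≠ l := fun h => h2 (by rw [← h, Fin.rev_rev])
  have h4 : Fin.rev j ≠ Fin.rev l := fun h => h1 (Fin.rev_injective h)
  have h5 := rev_ne_self j
  have h6 := rev_ne_self l
  change Equiv.swap j l (Equiv.swap (Fin.rev j) (Fin.rev l) m) = _
  simp only [Equiv.swap_apply_def]
  grind

theorem weylRefl_inv (j l : Fin (2 * n)) : (weylRefl j l)⁻¹ = weylRefl j l := by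
  rw [inv_eq_iff_mul_eq_one]
  apply Subtype.ext
  have h : (Equiv.swap j l * Equiv.swap (Fin.rev j) (Fin.rev l)) * (Equiv.swap j l *
      Equiv.swap (Fin.rev j) (Fin.rev l)) = 1 := by
    rw [mul_assoc, ← mul_assoc (Equiv.swap (Fin.rev j) _), ← (swap_commute_swap_rev j l).eq,
      mul_assoc (Equiv.swap j l), Equiv.swap_mul_self, mul_one, Equiv.swap_mul_self]
  exact h

theorem isEven_weylRefl {j l : Fin (2 * n)} (h1 : j ≠ l) : IsEven (weylRefl j l) := by
  change Equiv.Perm.sign (Equiv.swap j l * Equiv.swap (Fin.rev j) (Fin.rev l)) = 1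
  rw [Equiv.Perm.sign_mul, Equiv.Perm.sign_swap h1,
    Equiv.Perm.sign_swap fun h => h1 (Fin.rev_injective h)]
  rfl

theorem mul_weylRefl (σ : starPerm n) (j l : Fin (2 * n)) :
    σ * weylRefl j l = weylRefl ((σ : Equiv.Perm (Fin (2 * n))) j)
      ((σ : Equiv.Perm (Fin (2 * n))) l) * σ := by
  apply Subtype.ext
  change (σ : Equiv.Perm (Fin (2 * n))) * (Equiv.swap j l * Equiv.swap (Fin.rev j) (Fin.rev l)) =
    Equiv.swap _ _ * Equiv.swap _ _ * (σ : Equiv.Perm (Fin (2 * n)))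
  rw [← mul_assoc, Equiv.mul_swap_eq_swap_mul (σ : Equiv.Perm (Fin (2 * n))),
    mul_assoc _ (σ : Equiv.Perm (Fin (2 * n))),
    Equiv.mul_swap_eq_swap_mul (σ : Equiv.Perm (Fin (2 * n))), ← mul_assoc, starPerm_rev,
    starPerm_rev]

theorem permAct_weylRefl {R : Type*} [CommRing R] {j l : Fin (2 * n)} (h1 : j ≠ l)
    (h2 : j ≠ Fin.rev l) (x : Fin n → R) :
    permAct (weylRefl j l) x =
      x - (embed x j - embed x l) • fun i => (((letterVec j - letterVec l) i : ℤ) : R) := by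
  apply embed_ext
  intro m
  have hinv : (weylRefl j l : Equiv.Perm (Fin (2 * n)))⁻¹ = weylRefl j l :=
    congrArg Subtype.val (weylRefl_inv j l)
  rw [embed_permAct, embed_sub, embed_smul, embed_intCast, embed_sub, embed_letterVec,
    embed_letterVec, hinv, weylRefl_apply h1 h2]
  have h3 : Fin.rev j ≠ l := fun h => h2 (by rw [← h, Fin.rev_rev])
  have h4 : Fin.rev j ≠ Fin.rev l := fun h => h1 (Fin.rev_injective h)
  have h5 := rev_ne_self j
  have h6 := rev_ne_self l
  have h7 : ∀ k : Fin (2 * n), (Fin.rev m = k) = (m = Fin.rev k) := fun k => by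
    rw [eq_iff_iff]
    constructor
    · rintro rfl; exact (Fin.rev_rev m).symm
    · rintro rfl; exact Fin.rev_rev k
  simp only [h7]
  by_cases e1 : m = j
  · subst e1; simp [h1, h2, h5.symm]
  by_cases e2 : m = l
  · subst e2; simp [h1.symm, h3.symm, h6.symm]
  by_cases e3 : m = Fin.rev j
  · subst e3; simp [h3, h4, h5, embed_rev]; ring
  by_cases e4 : m = Fin.rev l
  · subst e4; simp [h2.symm, h4.symm, h6, embed_rev]; ring
  simp [e1, e2, e3, e4]

theorem permAct_letterVec (σ : starPerm n) (l : Fin (2 * n)) :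
    permAct σ (letterVec l) = letterVec ((σ : Equiv.Perm (Fin (2 * n))) l) := by
  apply embed_ext
  intro m
  rw [embed_permAct, embed_letterVec, embed_letterVec, ← starPerm_inv_rev]
  simp only [Equiv.Perm.inv_eq_iff_eq]

theorem permAct_sub {R : Type*} [AddCommGroup R] (σ : starPerm n) (x y : Fin n → R) :
    permAct σ (x - y) = permAct σ x - permAct σ y := by
  funext i
  exact embed_sub x y _

theorem permAct_smul {R : Type*} [CommRing R] (σ : starPerm n) (c : R) (x : Fin n → R) :
    permAct σ (c • x) = c • permAct σ x := by
  funext i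
  exact embed_smul c x _

/-! ### Elements of the Iwahori-Weyl group -/

theorem iwahoriWeyl_ext {w w' : IwahoriWeyl n} (h : transVec w = transVec w')
    (h' : linPart w = linPart w') : w = w' :=
  SemidirectProduct.ext (congrArg Multiplicative.ofAdd h) h'

theorem transVec_mul (w w' : IwahoriWeyl n) :
    transVec (w * w') = transVec w + permAct (linPart w) (transVec w') := rfl

theorem linPart_mul (w w' : IwahoriWeyl n) : linPart (w * w') = linPart w * linPart w' := rfl

theorem embed_act (w : IwahoriWeyl n) (x : Fin n → ℝ) (m : Fin (2 * n)) :
    embed (act w x) m = embed x ((linPart w : Equiv.Perm (Fin (2 * n)))⁻¹ m) +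
      (embed (transVec w) m : ℤ) := by
  rw [act, embed_add, embed_permAct, embed_intCast]

theorem act_mul (w w' : IwahoriWeyl n) (x : Fin n → ℝ) : act (w * w') x = act w (act w' x) := by
  apply embed_ext
  intro m
  rw [embed_act, embed_act, embed_act, transVec_mul, embed_add, embed_permAct, linPart_mul]
  simp only [Subgroup.coe_mul, mul_inv_rev, Equiv.Perm.mul_apply]
  push_cast
  ring

theorem act_one (x : Fin n → ℝ) : act (1 : IwahoriWeyl n) x = x := by
  have h : transVec (1 : IwahoriWeyl n) = 0 := rfl
  have h' : linPart (1 : IwahoriWeyl n) = 1 := rfl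
  rw [act, h, h', permAct_one]
  funext i
  simp

theorem starPerm_eq_of_permAct {σ τ : starPerm n}
    (h : ∀ x : Fin n → ℤ, permAct σ x = permAct τ x) : σ = τ := by
  apply Subtype.ext
  ext1 l
  have h1 := h (letterVec l)
  rw [permAct_letterVec, permAct_letterVec] at h1
  have h2 := congrArg (fun y => embed y ((σ : Equiv.Perm (Fin (2 * n))) l)) h1
  simp only [embed_letterVec, rev_ne_self, if_true, if_false, sub_zero] at h2
  by_contra hne
  rw [if_neg hne] at h2
  split_ifs at h2 <;> omega

/-- Simple reflections are specified by their action on `ℝⁿ`; faithfulness identifies them with the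
explicit elements `affRefl`. The image of `0` recovers the translation part, and the images of
integral vectors recover the linear part. -/
theorem act_injective : Function.Injective (act : IwahoriWeyl n → (Fin n → ℝ) → Fin n → ℝ) := by
  intro w w' h
  have h0 : transVec w = transVec w' := by
    apply embed_ext
    intro m
    have := congrArg (fun y => embed y m) (congrFun h 0)
    simp only [embed_act] at this
    have hz : ∀ k : Fin (2 * n), embed (0 : Fin n → ℝ) k = 0 := fun k => by
      unfold embed; split_ifs <;> simp
    rw [hz, hz, zero_add, zero_add] at this
    exact_mod_cast this
  refine iwahoriWeyl_ext h0 (starPerm_eq_of_permAct fun x => embed_ext fun m => ?_)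
  have := congrArg (fun y => embed y m) (congrFun h fun i => (x i : ℝ))
  simp only [embed_act, embed_intCast, h0] at this
  rw [embed_permAct, embed_permAct]
  exact_mod_cast add_right_cancel this

/-- The reflection in the affine root `e_j - e_l - k`, for letters `j` and `l`. -/
def affRefl (j l : Fin (2 * n)) (k : ℤ) : IwahoriWeyl n :=
  ⟨Multiplicative.ofAdd (k • (letterVec j - letterVec l)), weylRefl j l⟩

theorem transVec_affRefl (j l : Fin (2 * n)) (k : ℤ) :
    transVec (affRefl j l k) = k • (letterVec j - letterVec l) := rfl

theorem linPart_affRefl (j l : Fin (2 * n)) (k : ℤ) :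
    linPart (affRefl j l k) = weylRefl j l := rfl

theorem affRefl_mem {j l : Fin (2 * n)} (h1 : j ≠ l) (k : ℤ) : affRefl j l k ∈ affineWeyl n := by
  refine ⟨?_, isEven_weylRefl h1⟩
  simp only [transVec_affRefl, Pi.smul_apply, smul_eq_mul, ← Finset.mul_sum, Pi.sub_apply,
    Finset.sum_sub_distrib]
  exact ((odd_sum_letterVec j).sub_odd (odd_sum_letterVec l)).mul_left k

theorem act_affRefl {j l : Fin (2 * n)} (h1 : j ≠ l) (h2 : j ≠ Fin.rev l) (k : ℤ)
    (x : Fin n → ℝ) : act (affRefl j l k) x =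
      x - (embed x j - embed x l - k) • fun i => (((letterVec j - letterVec l) i : ℤ) : ℝ) := by
  rw [act, linPart_affRefl, permAct_weylRefl h1 h2, transVec_affRefl]
  funext i
  simp only [Pi.add_apply, Pi.sub_apply, Pi.smul_apply, smul_eq_mul, Int.cast_mul]
  ring

/-- Conjugating a reflection by `w` gives the reflection in the transported hyperplane; the
translation part of `w` shifts its constant term. -/
theorem mul_affRefl (w : IwahoriWeyl n) {j l : Fin (2 * n)} (h1 : j ≠ l) (h2 : j ≠ Fin.rev l)
    (k : ℤ) {j' l' : Fin (2 * n)} (hj : (linPart w : Equiv.Perm (Fin (2 * n))) j = j')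
    (hl : (linPart w : Equiv.Perm (Fin (2 * n))) l = l') :
    w * affRefl j l k =
      affRefl j' l' (k + embed (transVec w) j' - embed (transVec w) l') * w := by
  subst hj hl
  refine iwahoriWeyl_ext ?_ (mul_weylRefl _ _ _)
  rw [transVec_mul, transVec_mul, linPart_affRefl, transVec_affRefl, transVec_affRefl,
    permAct_weylRefl, permAct_smul, permAct_sub, permAct_letterVec, permAct_letterVec]
  · funext i
    simp only [Pi.add_apply, Pi.sub_apply, Pi.smul_apply, smul_eq_mul, Int.cast_id]
    ring
  · exact fun h => h1 (Equiv.injective _ h)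
  · rw [← starPerm_rev]
    exact fun h => h2 (Equiv.injective _ h)

theorem affRefl_mul_self {j l : Fin (2 * n)} (h1 : j ≠ l) (h2 : j ≠ Fin.rev l) (k : ℤ) :
    affRefl j l k * affRefl j l k = 1 := by
  refine iwahoriWeyl_ext ?_ (inv_eq_iff_mul_eq_one.1 (weylRefl_inv j l))
  have h3 : Fin.rev j ≠ l := fun h => h2 (by rw [← h, Fin.rev_rev])
  rw [transVec_mul, linPart_affRefl, transVec_affRefl, permAct_weylRefl h1 h2]
  simp only [embed_smul, embed_sub, embed_letterVec, if_neg h1, if_neg h1.symm, if_neg h3,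
    if_neg (rev_ne_self _), if_neg fun h : Fin.rev l = j => h2 h.symm]
  have h0 : transVec (1 : IwahoriWeyl n) = 0 := rfl
  rw [h0]
  funext i
  simp
  ring

/-! ### The base alcove -/

theorem pairing_add (α : Fin n → ℤ) (x y : Fin n → ℝ) :
    pairing α (x + y) = pairing α x + pairing α y := by
  simp only [pairing, Pi.add_apply, mul_add, Finset.sum_add_distrib]

theorem pairing_smul (α : Fin n → ℤ) (c : ℝ) (x : Fin n → ℝ) :
    pairing α (c • x) = c * pairing α x := by
  simp only [pairing, Pi.smul_apply, smul_eq_mul, Finset.mul_sum]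
  exact Finset.sum_congr rfl fun i _ => by ring

theorem pairing_sub (α : Fin n → ℤ) (x y : Fin n → ℝ) :
    pairing α (x - y) = pairing α x - pairing α y := by
  simp only [pairing, Pi.sub_apply, mul_sub, Finset.sum_sub_distrib]

theorem pairing_neg_left (α : Fin n → ℤ) (x : Fin n → ℝ) : pairing (-α) x = -pairing α x := by
  simp [pairing]

theorem pairing_comm (α β : Fin n → ℤ) :
    pairing α (fun i => (β i : ℝ)) = pairing β (fun i => (α i : ℝ)) :=
  Finset.sum_congr rfl fun _ _ => mul_comm _ _

theorem mem_baseAlcove {x : Fin n → ℝ}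
    (h : ∀ j l : Fin (2 * n), j < l → j ≠ Fin.rev l →
      0 < embed x j - embed x l ∧ embed x j - embed x l < 1) : x ∈ baseAlcove n := by
  constructor
  · rintro α ⟨i, j, hij, rfl | ⟨hj, rfl⟩⟩
    · rw [← letterVec_low, ← letterVec_low, pairing_letterVec_sub]
      exact (h _ _ (by rw [Fin.lt_def]; simp only [low]; omega) (low_ne_rev_low _ _)).1
    · rw [← letterVec_low, ← letterVec_low, ← sub_neg_eq_add, ← letterVec_rev,
        pairing_letterVec_sub]
      refine (h _ _ ?_ ?_).1
      · rw [Fin.lt_def, Fin.val_rev]; simp only [low]; omega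
      · rw [Fin.rev_rev]
        intro he
        have := low_injective he
        subst this
        omega
  · intro α hα
    obtain ⟨j, l, h1, h2, rfl⟩ := mem_roots_iff.1 hα
    rw [pairing_letterVec_sub]
    rcases lt_or_gt_of_ne h1 with h3 | h3
    · exact (h j l h3 h2).2
    · have := (h l j h3 fun h => h2 (by rw [h, Fin.rev_rev])).1
      linarith

theorem strictAnti_of_mem_baseAlcove {x : Fin n → ℝ} (hx : x ∈ baseAlcove n) {i j : Fin n}
    (hij : i < j) : x j < x i := by
  have key : ∀ d : ℕ, ∀ i j : Fin n, (j : ℕ) = i + d + 1 → x j < x i := by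
    intro d
    induction d with
    | zero =>
      intro i j hij
      have := hx.1 _ ⟨i, j, hij.symm, Or.inl rfl⟩
      rw [← letterVec_low, ← letterVec_low, pairing_letterVec_sub, embed_low, embed_low] at this
      linarith
    | succ d ih =>
      intro i j hij
      have h1 := ih i ⟨i + d + 1, by omega⟩ rfl
      have := hx.1 _ ⟨⟨i + d + 1, by omega⟩, j, by simp only; omega, Or.inl rfl⟩
      rw [← letterVec_low, ← letterVec_low, pairing_letterVec_sub, embed_low, embed_low] at this
      linarith
  rw [Fin.lt_def] at hij
  exact key (j - i - 1) i j (by omega)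

theorem add_pos_of_mem_baseAlcove {x : Fin n → ℝ} (hx : x ∈ baseAlcove n) {i j : Fin n}
    (hij : i < j) : 0 < x i + x j := by
  have hij' := hij
  rw [Fin.lt_def] at hij'
  have h1 := hx.1 _ ⟨⟨n - 2, by omega⟩, ⟨n - 1, by omega⟩, by simp only; omega,
    Or.inr ⟨by simp only; omega, rfl⟩⟩
  rw [← letterVec_low, ← letterVec_low, ← sub_neg_eq_add, ← letterVec_rev,
    pairing_letterVec_sub, embed_rev, embed_low, embed_low] at h1
  have h2 := strictAnti_of_mem_baseAlcove hx (i := ⟨n - 2, by omega⟩) (j := ⟨n - 1, by omega⟩)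
    (by rw [Fin.lt_def]; simp only; omega)
  have h3 : ∀ k : Fin n, (k : ℕ) ≤ n - 2 → x ⟨n - 2, by omega⟩ ≤ x k := by
    intro k hk
    rcases hk.lt_or_eq with h | h
    · exact (strictAnti_of_mem_baseAlcove hx (by rw [Fin.lt_def]; exact h)).le
    · rw [show k = ⟨n - 2, by omega⟩ from Fin.ext h]
  by_cases hj : (j : ℕ) ≤ n - 2
  · have := h3 i (by omega)
    have := h3 j hj
    linarith
  · have := h3 i (by omega)
    rw [show j = ⟨n - 1, by omega⟩ from Fin.ext (by simp only; omega)]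
    linarith

theorem sub_mem_Ioo_of_mem_baseAlcove {x : Fin n → ℝ} (hx : x ∈ baseAlcove n) {j l : Fin (2 * n)}
    (hjl : j < l) (hne : j ≠ Fin.rev l) :
    0 < embed x j - embed x l ∧ embed x j - embed x l < 1 := by
  constructor
  · rw [Fin.lt_def] at hjl
    rcases letter_cases j with ⟨a, rfl⟩ | ⟨a, rfl⟩ <;> rcases letter_cases l with ⟨b, rfl⟩ | ⟨b, rfl⟩
    · rw [embed_low, embed_low, sub_pos]
      exact strictAnti_of_mem_baseAlcove hx hjl
    · rw [embed_rev, embed_low, embed_low, sub_neg_eq_add]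
      rw [Fin.rev_rev] at hne
      rcases lt_trichotomy a b with h | rfl | h
      · exact add_pos_of_mem_baseAlcove hx h
      · exact absurd rfl hne
      · rw [add_comm]; exact add_pos_of_mem_baseAlcove hx h
    · rw [Fin.val_rev] at hjl
      simp only [low] at hjl
      omega
    · rw [embed_rev, embed_rev, embed_low, embed_low]
      have := strictAnti_of_mem_baseAlcove hx (i := b) (j := a) (by
        rw [Fin.val_rev, Fin.val_rev] at hjl
        simp only [low] at hjl
        rw [Fin.lt_def]
        omega)
      linarith
  · have := hx.2 _ (mem_roots_iff.2 ⟨j, l, hjl.ne, hne, rfl⟩)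
    rwa [pairing_letterVec_sub] at this

/-- No affine root changes sign on the base alcove. -/
theorem mul_pos_of_mem_baseAlcove {x y : Fin n → ℝ} (hx : x ∈ baseAlcove n)
    (hy : y ∈ baseAlcove n) {j l : Fin (2 * n)} (h1 : j ≠ l) (h2 : j ≠ Fin.rev l) (m : ℤ) :
    0 < (embed x j - embed x l - m) * (embed y j - embed y l - m) := by
  have key : ∀ {j l : Fin (2 * n)}, j < l → j ≠ Fin.rev l → ∀ m : ℤ,
      0 < (embed x j - embed x l - m) * (embed y j - embed y l - m) := by
    intro j l h1 h2 m
    have hx' := sub_mem_Ioo_of_mem_baseAlcove hx h1 h2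
    have hy' := sub_mem_Ioo_of_mem_baseAlcove hy h1 h2
    rcases le_or_gt m 0 with hm | hm
    · have : (m : ℝ) ≤ 0 := by exact_mod_cast hm
      exact mul_pos (by linarith) (by linarith)
    · have : (1 : ℝ) ≤ m := by exact_mod_cast hm
      exact mul_pos_of_neg_of_neg (by linarith) (by linarith)
  rcases lt_or_gt_of_ne h1 with h3 | h3
  · exact key h3 h2 m
  · have := key h3 (fun h => h2 (by rw [h, Fin.rev_rev])) (-m)
    push_cast at this
    convert this using 1
    ring

/-- The half sum of the positive roots. -/
def rho (n : ℕ) : Fin n → ℤ := fun i => n - 1 - (i : ℕ)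

theorem embed_rho (l : Fin (2 * n)) :
    embed (rho n) l = if (l : ℕ) < n then (n : ℤ) - 1 - (l : ℕ) else (n : ℤ) - (l : ℕ) := by
  unfold embed rho
  split_ifs
  · rfl
  · have := l.2
    simp only
    omega

/-- Pairing with `ρ` gives the height of a positive root, which runs from `1` to `h - 1` for `h = 2n
- 2`. Positivity of a root means that its letters are in increasing order. -/
theorem rho_sub_bounds {j l : Fin (2 * n)} (hjl : j < l) (hne : j ≠ Fin.rev l) :
    1 ≤ embed (rho n) j - embed (rho n) l ∧
      embed (rho n) j - embed (rho n) l + 1 ≤ 2 * (n : ℤ) - 2 := by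
  rw [embed_rho, embed_rho]
  have hj := j.2
  have hl := l.2
  rw [Fin.lt_def] at hjl
  rw [Ne, Fin.ext_iff, Fin.val_rev] at hne
  split_ifs <;> omega

/-- The half sum of the positive roots divided by the Coxeter number `2n - 2`. -/
noncomputable def basePoint (n : ℕ) : Fin n → ℝ := fun i => (rho n i : ℝ) / (2 * n - 2)

theorem two_mul_sub_two_pos (hn : 2 ≤ n) : (0 : ℝ) < 2 * n - 2 := by
  have : (2 : ℝ) ≤ n := by exact_mod_cast hn
  linarith

theorem embed_basePoint (l : Fin (2 * n)) :
    embed (basePoint n) l = (embed (rho n) l : ℤ) / (2 * n - 2 : ℝ) := by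
  unfold embed basePoint
  split_ifs
  · rfl
  · push_cast; ring

theorem basePoint_mem (hn : 2 ≤ n) : basePoint n ∈ baseAlcove n := by
  refine mem_baseAlcove fun j l hjl hne => ?_
  obtain ⟨h1, h2⟩ := rho_sub_bounds hjl hne
  have h1' : (1 : ℝ) ≤ (embed (rho n) j : ℤ) - (embed (rho n) l : ℤ) := by exact_mod_cast h1
  have h2' : ((embed (rho n) j : ℤ) : ℝ) - (embed (rho n) l : ℤ) + 1 ≤ 2 * n - 2 := by
    exact_mod_cast h2
  have hM := two_mul_sub_two_pos hn
  rw [embed_basePoint, embed_basePoint, ← sub_div]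
  exact ⟨div_pos (by linarith) hM, (div_lt_one hM).2 (by linarith)⟩

/-- The half-open segment from `x` to the interior point `basePoint n`, without `x` itself, lies in
the alcove. -/
theorem mem_closure_baseAlcove (hn : 2 ≤ n) {x : Fin n → ℝ}
    (h : ∀ j l : Fin (2 * n), j < l → j ≠ Fin.rev l →
      0 ≤ embed x j - embed x l ∧ embed x j - embed x l ≤ 1) : x ∈ closure (baseAlcove n) := by
  have hcont : Continuous fun δ : ℝ => x + δ • (basePoint n - x) := by fun_prop
  have hlim : Filter.Tendsto (fun δ : ℝ => x + δ • (basePoint n - x)) (nhdsWithin 0 (Set.Ioc 0 1))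
      (nhds x) := by
    have := (hcont.tendsto 0).mono_left (nhdsWithin_le_nhds (s := Set.Ioc (0 : ℝ) 1))
    simpa using this
  have : (nhdsWithin (0 : ℝ) (Set.Ioc 0 1)).NeBot := by
    rw [nhdsWithin_Ioc_eq_nhdsGT one_pos]
    infer_instance
  refine mem_closure_of_tendsto hlim ?_
  filter_upwards [self_mem_nhdsWithin] with δ hδ
  refine mem_baseAlcove fun j l hjl hne => ?_
  obtain ⟨h1, h2⟩ := h j l hjl hne
  obtain ⟨h3, h4⟩ := sub_mem_Ioo_of_mem_baseAlcove (basePoint_mem hn) hjl hne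
  simp only [embed_add, embed_smul, embed_sub]
  have e : embed x j + δ * (embed (basePoint n) j - embed x j) -
      (embed x l + δ * (embed (basePoint n) l - embed x l)) =
      (1 - δ) * (embed x j - embed x l) +
        δ * (embed (basePoint n) j - embed (basePoint n) l) := by ring
  rw [e]
  have h5 := mul_nonneg (sub_nonneg.2 hδ.2) h1
  have h6 := mul_le_mul_of_nonneg_left h2 (sub_nonneg.2 hδ.2)
  have h7 := mul_pos hδ.1 h3
  have h8 := mul_lt_mul_of_pos_left h4 hδ.1
  constructor <;> linarith

/-! ### Walls -/

/-- A hyperplane as an affine subspace. -/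
def hyperplaneSubspace (α : Fin n → ℤ) (k : ℤ) : AffineSubspace ℝ (Fin n → ℝ) where
  carrier := hyperplane α k
  smul_vsub_vadd_mem' c p₁ p₂ p₃ h₁ h₂ h₃ := by
    simp only [hyperplane, Set.mem_ofPred_eq] at *
    rw [vsub_eq_sub, vadd_eq_add, pairing_add, pairing_smul, pairing_sub, h₁, h₂, h₃]
    ring

theorem affineSpan_subset_hyperplane {s : Set (Fin n → ℝ)} {α : Fin n → ℤ} {k : ℤ}
    (h : s ⊆ hyperplane α k) : (affineSpan ℝ s : Set (Fin n → ℝ)) ⊆ hyperplane α k :=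
  affineSpan_le (Q := hyperplaneSubspace α k).2 h

theorem letterVec_rev_sub_rev (j l : Fin (2 * n)) :
    letterVec (Fin.rev j) - letterVec (Fin.rev l) = letterVec l - letterVec j := by
  rw [letterVec_rev, letterVec_rev, neg_sub_neg]

theorem embed_root_cases {j l : Fin (2 * n)} (h1 : j ≠ l) (h2 : j ≠ Fin.rev l) (p : Fin (2 * n)) :
    (embed (letterVec j - letterVec l) p = 1 ∧ (p = j ∨ p = Fin.rev l)) ∨
      (embed (letterVec j - letterVec l) p = -1 ∧ (p = l ∨ p = Fin.rev j)) ∨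
      embed (letterVec j - letterVec l) p = 0 := by
  have h3 : Fin.rev j ≠ l := fun h => h2 (by rw [← h, Fin.rev_rev])
  have h4 : Fin.rev j ≠ Fin.rev l := fun h => h1 (Fin.rev_injective h)
  have h5 := rev_ne_self j
  have h6 := rev_ne_self l
  have h7 : ∀ k : Fin (2 * n), (Fin.rev p = k) = (p = Fin.rev k) := fun k => by
    rw [eq_iff_iff]
    constructor
    · rintro rfl; exact (Fin.rev_rev p).symm
    · rintro rfl; exact Fin.rev_rev k
  simp only [embed_sub, embed_letterVec, h7]
  by_cases e1 : p = j
  · subst e1; simp [h1, h2, h5.symm]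
  by_cases e2 : p = l
  · subst e2; simp [h1.symm, h3.symm, h6.symm]
  by_cases e3 : p = Fin.rev j
  · subst e3; simp [h3, h4, h5]
  by_cases e4 : p = Fin.rev l
  · subst e4; simp [h2.symm, h4.symm, h6]
  simp [e1, e2, e3, e4]

/-- Two roots are equal up to sign, or their inner product has absolute value at most one. -/
theorem root_trichotomy {j l p q : Fin (2 * n)} (h1 : j ≠ l) (h2 : j ≠ Fin.rev l)
    (h4 : p ≠ Fin.rev q) :
    letterVec p - letterVec q = letterVec j - letterVec l ∨
      letterVec p - letterVec q = -(letterVec j - letterVec l) ∨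
      |embed (letterVec j - letterVec l) p - embed (letterVec j - letterVec l) q| ≤ 1 := by
  rcases embed_root_cases h1 h2 p with ⟨e, hp⟩ | ⟨e, hp⟩ | e <;>
    rcases embed_root_cases h1 h2 q with ⟨e', hq⟩ | ⟨e', hq⟩ | e'
  · right; right; rw [e, e']; norm_num
  · left
    rcases hp with hp | hp <;> rcases hq with hq | hq
    · rw [hp, hq]
    · exact absurd (by rw [hp, hq, Fin.rev_rev]) h4
    · exact absurd (by rw [hp, hq]) h4
    · rw [hp, hq, letterVec_rev_sub_rev]
  · right; right; rw [e, e']; norm_num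
  · right; left
    rw [neg_sub]
    rcases hp with hp | hp <;> rcases hq with hq | hq
    · rw [hp, hq]
    · exact absurd (by rw [hp, hq, Fin.rev_rev]) h4
    · exact absurd (by rw [hp, hq]) h4
    · rw [hp, hq, letterVec_rev_sub_rev]
  · right; right; rw [e, e']; norm_num
  · right; right; rw [e, e']; norm_num
  · right; right; rw [e, e']; norm_num
  · right; right; rw [e, e']; norm_num
  · right; right; rw [e, e']; norm_num

theorem embed_root_self {j l : Fin (2 * n)} (h1 : j ≠ l) (h2 : j ≠ Fin.rev l) :
    embed (letterVec j - letterVec l) j - embed (letterVec j - letterVec l) l = 2 := by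
  have h3 : Fin.rev j ≠ l := fun h => h2 (by rw [← h, Fin.rev_rev])
  simp only [embed_sub, embed_letterVec, if_neg h1, if_neg h1.symm, if_neg h3,
    if_neg (rev_ne_self _), if_neg fun h : Fin.rev l = j => h2 h.symm]
  simp

theorem abs_embed_le (x : Fin n → ℝ) (l : Fin (2 * n)) : |embed x l| ≤ ∑ i, |x i| := by
  rcases letter_cases l with ⟨i, rfl⟩ | ⟨i, rfl⟩
  · rw [embed_low]
    exact Finset.single_le_sum (f := fun i => |x i|) (fun _ _ => abs_nonneg _) (Finset.mem_univ i)
  · rw [embed_rev, embed_low, abs_neg]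
    exact Finset.single_le_sum (f := fun i => |x i|) (fun _ _ => abs_nonneg _) (Finset.mem_univ i)

/-- The orthogonal projection `c` of the base point to the hyperplane lies in the interior of a
facet. The projection moves any root other than `±α` by at most `1 / (2M)`, while the value of such
a positive root at the base point is at distance at least `1 / M` from `0` and `1`. So a
neighbourhood of `c` in the hyperplane stays in the closed alcove, and it spans the hyperplane. -/
theorem isWall_of_rho_sub (hn : 2 ≤ n) {j l : Fin (2 * n)} (h1 : j ≠ l) (h2 : j ≠ Fin.rev l)
    {k : ℤ} (hk : |embed (rho n) j - embed (rho n) l - (2 * n - 2) * k| = 1) :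
    IsWall (hyperplane (letterVec j - letterVec l) k) := by
  have hM := two_mul_sub_two_pos hn
  set M : ℝ := 2 * n - 2 with hMdef
  set u : ℤ := embed (rho n) j - embed (rho n) l - (2 * n - 2) * k with hu
  have hu' : (u : ℝ) = (embed (rho n) j : ℤ) - (embed (rho n) l : ℤ) - M * k := by
    rw [hu, hMdef]; push_cast; ring
  set α : Fin n → ℤ := letterVec j - letterVec l with hα
  -- The base point is at root value `u / M` from the hyperplane, and `α` takes the value `2` on
  -- itself, hence the coefficient `u / (2M)`.
  set c : Fin n → ℝ := basePoint n - (u / (2 * M)) • fun i => (α i : ℝ) with hc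
  have hcl : ∀ p, embed c p = (embed (rho n) p : ℤ) / M - u / (2 * M) * (embed α p : ℤ) := by
    intro p
    rw [hc, embed_sub, embed_smul, embed_intCast, embed_basePoint]
  have hself : ((embed α j : ℤ) : ℝ) - (embed α l : ℤ) = 2 := by
    exact_mod_cast embed_root_self h1 h2
  have hck : embed c j - embed c l = k := by
    rw [hcl, hcl, show ((embed (rho n) j : ℤ) : ℝ) = u + M * k + (embed (rho n) l : ℤ) by
      rw [hu']; ring, show ((embed α j : ℤ) : ℝ) = 2 + (embed α l : ℤ) by rw [← hself]; ring]
    field_simp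
    ring
  clear_value c
  -- The bound on `ε` keeps the change of any root value along `ε • (z - c)` below the remaining
  -- margin `1 / (2M)`.
  have hmem : ∀ z : Fin n → ℝ, pairing α z = k → ∀ ε : ℝ, 0 ≤ ε →
      ε * (4 * M * (∑ i, |(z - c) i| + 1)) ≤ 1 → c + ε • (z - c) ∈ closure (baseAlcove n) := by
    intro z hz ε hε0 hε
    rw [hα, pairing_letterVec_sub] at hz
    refine mem_closure_baseAlcove hn fun p q hpq hne => ?_
    obtain ⟨hb1, hb2⟩ := rho_sub_bounds hpq hne
    simp only [embed_add, embed_smul]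
    -- For the roots `±α`, constant on the hyperplane, the value there is an integer at distance `1
    -- / M` from a number strictly between `0` and `1`, so it is `0` or `1`.
    have hpm : ∀ t : ℤ, |embed (rho n) p - embed (rho n) q - (2 * n - 2) * t| = 1 →
        (0 : ℝ) ≤ t ∧ (t : ℝ) ≤ 1 := by
      intro t ht
      have hn' : (2 : ℤ) ≤ n := by exact_mod_cast hn
      have h0 : 0 ≤ t := by
        by_contra hcon
        have : (2 * (n : ℤ) - 2) * t ≤ -2 := by nlinarith
        rcases abs_eq (zero_le_one) |>.1 ht with h | h <;> linarith
      have h1 : t ≤ 1 := by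
        by_contra hcon
        have : (2 * (n : ℤ) - 2) * 2 ≤ (2 * (n : ℤ) - 2) * t :=
          mul_le_mul_of_nonneg_left (by omega) (by omega)
        rcases abs_eq (zero_le_one) |>.1 ht with h | h <;> linarith
      exact ⟨by exact_mod_cast h0, by exact_mod_cast h1⟩
    have hlin : ∀ x : Fin n → ℝ, embed x p - embed x q =
        pairing (letterVec p - letterVec q) x := fun x => (pairing_letterVec_sub p q x).symm
    have hlinR : embed (rho n) p - embed (rho n) q =
        ∑ i, (letterVec p - letterVec q) i * rho n i := by
      simp only [Pi.sub_apply, sub_mul, Finset.sum_sub_distrib]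
      have := sum_letterVec_mul (R := ℤ) p (rho n)
      have := sum_letterVec_mul (R := ℤ) q (rho n)
      simp_all
    have hlinR' : embed (rho n) j - embed (rho n) l =
        ∑ i, (letterVec j - letterVec l) i * rho n i := by
      simp only [Pi.sub_apply, sub_mul, Finset.sum_sub_distrib]
      have := sum_letterVec_mul (R := ℤ) j (rho n)
      have := sum_letterVec_mul (R := ℤ) l (rho n)
      simp_all
    have hgoal : embed c p + ε * embed (z - c) p - (embed c q + ε * embed (z - c) q) =
        (embed c p - embed c q) + ε * (embed (z - c) p - embed (z - c) q) := by ring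
    rw [hgoal]
    rcases root_trichotomy h1 h2 hne with h | h | h
    · have e : ∀ x : Fin n → ℝ, embed x p - embed x q = embed x j - embed x l := fun x => by
        rw [hlin, h, pairing_letterVec_sub]
      rw [e, e, hck, embed_sub, embed_sub, show embed z j - embed c j - (embed z l - embed c l) =
        (embed z j - embed z l) - (embed c j - embed c l) by ring, hz, hck, sub_self, mul_zero,
        add_zero]
      refine hpm k ?_
      rw [hlinR, h, ← hlinR', ← hu, hk]
    · have e : ∀ x : Fin n → ℝ, embed x p - embed x q = -(embed x j - embed x l) := fun x => by
        rw [hlin, h, pairing_neg_left, pairing_letterVec_sub]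
      rw [e, e, hck, embed_sub, embed_sub, show embed z j - embed c j - (embed z l - embed c l) =
        (embed z j - embed z l) - (embed c j - embed c l) by ring, hz, hck, sub_self, neg_zero,
        mul_zero, add_zero]
      have := hpm (-k) ?_
      · push_cast at this; exact this
      · rw [hlinR, h]
        simp only [Pi.neg_apply, neg_mul, Finset.sum_neg_distrib]
        rw [← hlinR', ← abs_neg, ← hk, hu]
        congr 1
        ring
    · have hcpq : embed c p - embed c q = (((embed (rho n) p : ℤ) : ℝ) - (embed (rho n) q : ℤ) -
          u * (((embed α p : ℤ) : ℝ) - (embed α q : ℤ)) / 2) / M := by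
        rw [hcl, hcl]; field_simp; ring
      have hprod : |(u : ℝ) * (((embed α p : ℤ) : ℝ) - (embed α q : ℤ))| ≤ 1 := by
        rw [abs_mul]
        have e1 : |(u : ℝ)| = 1 := by exact_mod_cast hk
        have e2 : |((embed α p : ℤ) : ℝ) - (embed α q : ℤ)| ≤ 1 := by exact_mod_cast h
        rw [e1, one_mul]; exact e2
      have hd : |embed (z - c) p - embed (z - c) q| ≤ 2 * ∑ i, |(z - c) i| := by
        refine (abs_sub _ _).trans ?_
        have := abs_embed_le (z - c) p
        have := abs_embed_le (z - c) q
        linarith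
      set B := ∑ i, |(z - c) i|
      have hεd : |M * (ε * (embed (z - c) p - embed (z - c) q))| ≤ 1 / 2 := by
        rw [abs_mul, abs_mul, abs_of_pos hM, abs_of_nonneg hε0]
        have := mul_le_mul_of_nonneg_left hd (mul_nonneg hM.le hε0)
        nlinarith [mul_nonneg hM.le hε0]
      rw [abs_le] at hprod hεd
      have h1' : (1 : ℝ) ≤ (embed (rho n) p : ℤ) - (embed (rho n) q : ℤ) := by exact_mod_cast hb1
      have h2' : ((embed (rho n) p : ℤ) : ℝ) - (embed (rho n) q : ℤ) + 1 ≤ M := by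
        rw [hMdef]; exact_mod_cast hb2
      have hfin : embed c p - embed c q + ε * (embed (z - c) p - embed (z - c) q) =
          (((embed (rho n) p : ℤ) : ℝ) - (embed (rho n) q : ℤ) -
          u * (((embed α p : ℤ) : ℝ) - (embed α q : ℤ)) / 2 +
          M * (ε * (embed (z - c) p - embed (z - c) q))) / M := by
        rw [hcpq]; field_simp
      rw [hfin]
      exact ⟨div_nonneg (by linarith) hM.le, (div_le_one hM).2 (by linarith)⟩
  have hcH : c ∈ hyperplane α k := by
    change pairing α c = k
    rw [hα, pairing_letterVec_sub, hck]
  apply Set.Subset.antisymm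
  · exact affineSpan_subset_hyperplane Set.inter_subset_right
  · intro z hz
    set B := ∑ i, |(z - c) i| with hB
    have hB0 : 0 ≤ B := Finset.sum_nonneg fun _ _ => abs_nonneg _
    set ε : ℝ := 1 / (4 * M * (B + 1)) with hε
    have hden : 0 < 4 * M * (B + 1) := by positivity
    have hε0 : 0 < ε := by positivity
    have m1 : c + ε • (z - c) ∈ closure (baseAlcove n) :=
      hmem z hz ε hε0.le (by rw [hε]; field_simp; exact le_refl _)
    have m0 : c ∈ closure (baseAlcove n) := by
      have := hmem z hz 0 le_rfl (by rw [zero_mul]; exact zero_le_one)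
      simpa using this
    have m1' : c + ε • (z - c) ∈ hyperplane α k := by
      change pairing α _ = k
      change pairing α z = k at hz
      change pairing α c = k at hcH
      rw [pairing_add, pairing_smul, pairing_sub, hz, hcH]
      ring
    -- Any `z` of the hyperplane is on the line through `c` and the nearby point `c + ε • (z - c)`,
    -- at parameter `1 / ε`.
    have := AffineMap.lineMap_mem (Q := affineSpan ℝ (closure (baseAlcove n) ∩ hyperplane α k))
      (1 / ε) (subset_affineSpan ℝ _ ⟨m0, hcH⟩) (subset_affineSpan ℝ _ ⟨m1, m1'⟩)
    have e : AffineMap.lineMap c (c + ε • (z - c)) (1 / ε) = z := by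
      rw [AffineMap.lineMap_apply, vsub_eq_sub, vadd_eq_add, add_sub_cancel_left, smul_smul,
        one_div_mul_cancel hε0.ne', one_smul, sub_add_cancel]
    rw [e] at this
    exact this

theorem affRefl_mem_simpleReflections (hn : 2 ≤ n) {j l : Fin (2 * n)} (h1 : j ≠ l)
    (h2 : j ≠ Fin.rev l) {k : ℤ}
    (hk : |embed (rho n) j - embed (rho n) l - (2 * n - 2) * k| = 1) :
    (⟨affRefl j l k, affRefl_mem h1 k⟩ : affineWeyl n) ∈ simpleReflections n := by
  refine ⟨_, mem_roots_iff.2 ⟨j, l, h1, h2, rfl⟩, k, isWall_of_rho_sub hn h1 h2 hk, fun x => ?_⟩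
  rw [pairing_letterVec_sub]
  exact act_affRefl h1 h2 k x

/-- A hyperplane that separates the base alcove from its image under a simple reflection is the
wall of this reflection. -/
theorem eq_affRefl_of_separates (hn : 2 ≤ n) {s : affineWeyl n} (hs : s ∈ simpleReflections n)
    {p q : Fin (2 * n)} (h3 : p ≠ q) (h4 : p ≠ Fin.rev q) {m : ℤ}
    (hsep : (embed (basePoint n) p - embed (basePoint n) q - m) *
      (embed (act (s : IwahoriWeyl n) (basePoint n)) p -
        embed (act (s : IwahoriWeyl n) (basePoint n)) q - m) < 0) :
    (s : IwahoriWeyl n) = affRefl p q m := by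
  obtain ⟨α, hα, k, hwall, hact⟩ := hs
  obtain ⟨j, l, h1, h2, rfl⟩ := mem_roots_iff.1 hα
  set α : Fin n → ℤ := letterVec j - letterVec l with hαdef
  have ha := basePoint_mem hn
  set a := basePoint n
  have hembc : ∀ r : Fin (2 * n), Continuous fun x : Fin n → ℝ => embed x r := by
    intro r
    unfold embed
    split_ifs <;> fun_prop
  have hsub : closure (baseAlcove n) ∩ hyperplane α k ⊆ hyperplane (letterVec p - letterVec q) m := by
    rintro c ⟨hc, hcH⟩
    change pairing _ _ = _ at hcH
    -- A point `c` of the wall is in the closure of both the alcove and its image under `s`. It is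
    -- therefore weakly on both sides of the separating hyperplane, hence on it.
    have hfix : act (s : IwahoriWeyl n) c = c := by rw [hact, hcH, sub_self, zero_smul, sub_zero]
    have hc1 : 0 ≤ (embed a p - embed a q - m) * (embed c p - embed c q - m) := by
      have hcl : IsClosed {x : Fin n → ℝ |
          0 ≤ (embed a p - embed a q - m) * (embed x p - embed x q - m)} :=
        isClosed_le continuous_const
          (continuous_const.mul (((hembc p).sub (hembc q)).sub continuous_const))
      exact closure_minimal (fun x hx => (mul_pos_of_mem_baseAlcove ha hx h3 h4 m).le) hcl hc
    have hc2 : 0 ≤ (embed (act (s : IwahoriWeyl n) a) p - embed (act (s : IwahoriWeyl n) a) q - m) *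
        (embed c p - embed c q - m) := by
      have hcl : IsClosed {x : Fin n → ℝ | 0 ≤ (embed (act (s : IwahoriWeyl n) a) p -
          embed (act (s : IwahoriWeyl n) a) q - m) * (embed (act (s : IwahoriWeyl n) x) p -
          embed (act (s : IwahoriWeyl n) x) q - m)} := by
        simp only [embed_act]
        exact isClosed_le continuous_const (continuous_const.mul ((((hembc _).add
          continuous_const).sub ((hembc _).add continuous_const)).sub continuous_const))
      have := closure_minimal (fun x hx => ?_) hcl hc
      · rw [Set.mem_ofPred_eq, hfix] at this
        exact this
      · rw [Set.mem_ofPred_eq]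
        simp only [embed_act]
        have := mul_pos_of_mem_baseAlcove ha hx
          (j := (linPart (s : IwahoriWeyl n) : Equiv.Perm (Fin (2 * n)))⁻¹ p)
          (l := (linPart (s : IwahoriWeyl n) : Equiv.Perm (Fin (2 * n)))⁻¹ q)
          (fun h => h3 (Equiv.injective _ h))
          (by rw [← starPerm_inv_rev]; exact fun h => h4 (Equiv.injective _ h))
          (m - embed (transVec (s : IwahoriWeyl n)) p + embed (transVec (s : IwahoriWeyl n)) q)
        push_cast at this
        refine le_of_lt (lt_of_lt_of_eq this ?_)
        ring
    change pairing _ _ = _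
    rw [pairing_letterVec_sub]
    by_contra hne
    have hpos : 0 < (embed c p - embed c q - m) ^ 2 := by
      have : embed c p - embed c q - m ≠ 0 := sub_ne_zero.2 hne
      positivity
    nlinarith [mul_nonneg hc1 hc2, mul_neg_of_neg_of_pos hsep hpos]
  have hH : hyperplane α k ⊆ hyperplane (letterVec p - letterVec q) m := by
    rw [← hwall]
    exact affineSpan_subset_hyperplane hsub
  have hself : pairing α (fun i => (α i : ℝ)) = 2 := by
    rw [hαdef, pairing_letterVec_sub, embed_intCast, embed_intCast]
    exact_mod_cast embed_root_self h1 h2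
  have hself' : pairing (letterVec p - letterVec q)
      (fun i => ((letterVec p - letterVec q : Fin n → ℤ) i : ℝ)) = 2 := by
    rw [pairing_letterVec_sub, embed_intCast, embed_intCast]
    exact_mod_cast embed_root_self h3 h4
  set β : Fin n → ℤ := letterVec p - letterVec q with hβ
  have hx0 : pairing α ((k / 2 : ℝ) • fun i => (α i : ℝ)) = k := by
    rw [pairing_smul, hself]; ring
  have hx0' : pairing β ((k / 2 : ℝ) • fun i => (α i : ℝ)) = m := hH hx0
  apply act_injective
  funext x
  rw [hact, act_affRefl h3 h4, ← pairing_letterVec_sub, ← hβ]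
  rcases root_trichotomy h1 h2 h4 with h | h | h
  · have h' : β = α := h
    rw [h', hx0] at hx0'
    rw [h', hx0']
  · have h' : β = -α := h
    rw [h', pairing_neg_left, hx0] at hx0'
    rw [h', pairing_neg_left, ← hx0']
    funext i
    simp only [Pi.sub_apply, Pi.smul_apply, smul_eq_mul, Pi.neg_apply, Int.cast_neg]
    ring
  · exfalso
    have hr : |pairing β (fun i => (α i : ℝ))| ≤ 1 := by
      rw [hβ, pairing_letterVec_sub, embed_intCast, embed_intCast]
      exact_mod_cast h
    -- The vector `β - (r/2) α` is parallel to the wall, so `β` must vanish on it: `2 - r²/2 = 0`,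
    -- which `|r| ≤ 1` excludes.
    set r := pairing β (fun i => (α i : ℝ)) with hrdef
    have hz : pairing α ((k / 2 : ℝ) • (fun i => (α i : ℝ)) +
        ((fun i => (β i : ℝ)) - (r / 2) • fun i => (α i : ℝ))) = k := by
      rw [pairing_add, pairing_sub, hx0, pairing_smul, hself, pairing_comm, ← hrdef]; ring
    have hz' : pairing β ((k / 2 : ℝ) • (fun i => (α i : ℝ)) +
        ((fun i => (β i : ℝ)) - (r / 2) • fun i => (α i : ℝ))) = m := hH hz
    rw [pairing_add, pairing_sub, hx0', pairing_smul, hself', ← hrdef] at hz'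
    rw [abs_le] at hr
    nlinarith

/-! ### The orbit of the base point -/

/-- The image of `basePoint n` under `w`, multiplied by `2n - 2`. -/
def scaledPoint (w : IwahoriWeyl n) : Fin n → ℤ :=
  permAct (linPart w) (rho n) + (2 * (n : ℤ) - 2) • transVec w

/-- The affine root `e_j - e_l - k`, multiplied by `2n - 2`, at a point of the scaled lattice. -/
def rootValue (j l : Fin (2 * n)) (k : ℤ) (x : Fin n → ℤ) : ℤ :=
  embed x j - embed x l - (2 * n - 2) * k

theorem embed_scaledPoint (w : IwahoriWeyl n) (m : Fin (2 * n)) :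
    embed (scaledPoint w) m = embed (rho n) ((linPart w : Equiv.Perm (Fin (2 * n)))⁻¹ m) +
      (2 * n - 2) * embed (transVec w) m := by
  rw [scaledPoint, embed_add, embed_permAct, embed_smul]

theorem scaledPoint_one : scaledPoint (1 : IwahoriWeyl n) = rho n := by
  have h : transVec (1 : IwahoriWeyl n) = 0 := rfl
  have h' : linPart (1 : IwahoriWeyl n) = 1 := rfl
  rw [scaledPoint, h, h', permAct_one, smul_zero, add_zero]

theorem scaledPoint_mul (w w' : IwahoriWeyl n) : scaledPoint (w * w') =
    permAct (linPart w) (scaledPoint w') + (2 * (n : ℤ) - 2) • transVec w := by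
  rw [scaledPoint, scaledPoint, transVec_mul, linPart_mul, permAct_mul, permAct_add, permAct_smul,
    smul_add]
  abel

theorem scaledPoint_affRefl_mul {j l : Fin (2 * n)} (h1 : j ≠ l) (h2 : j ≠ Fin.rev l) (k : ℤ)
    (w : IwahoriWeyl n) : scaledPoint (affRefl j l k * w) =
      scaledPoint w - rootValue j l k (scaledPoint w) • (letterVec j - letterVec l) := by
  rw [scaledPoint_mul, linPart_affRefl, transVec_affRefl, permAct_weylRefl h1 h2, rootValue]
  funext i
  simp only [Pi.add_apply, Pi.sub_apply, Pi.smul_apply, smul_eq_mul, Int.cast_id]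
  ring

theorem rootValue_affRefl_mul {j l : Fin (2 * n)} (h1 : j ≠ l) (h2 : j ≠ Fin.rev l) (k : ℤ)
    (w : IwahoriWeyl n) : rootValue j l k (scaledPoint (affRefl j l k * w)) =
      -rootValue j l k (scaledPoint w) := by
  rw [scaledPoint_affRefl_mul h1 h2]
  have h := embed_root_self h1 h2
  set r := rootValue j l k (scaledPoint w) with hr
  unfold rootValue at hr ⊢
  rw [embed_sub, embed_sub, embed_smul, embed_smul]
  linear_combination (-r) * h - hr

/-- Evaluating an affine root after applying `w` amounts to evaluating the root pulled back along
`w`. This drives the induction in `strong_exchange_word`. -/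
theorem rootValue_mul (j l : Fin (2 * n)) (k : ℤ) (w w' : IwahoriWeyl n) :
    rootValue j l k (scaledPoint (w * w')) =
      rootValue ((linPart w : Equiv.Perm (Fin (2 * n)))⁻¹ j)
        ((linPart w : Equiv.Perm (Fin (2 * n)))⁻¹ l)
        (k - embed (transVec w) j + embed (transVec w) l) (scaledPoint w') := by
  rw [scaledPoint_mul]
  unfold rootValue
  rw [embed_add, embed_add, embed_permAct, embed_permAct, embed_smul, embed_smul]
  ring

theorem rootValue_rho_ne_zero {j l : Fin (2 * n)} (h1 : j ≠ l) (h2 : j ≠ Fin.rev l) (k : ℤ) :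
    rootValue j l k (rho n) ≠ 0 := by
  have key : ∀ {j l : Fin (2 * n)}, j < l → j ≠ Fin.rev l → ∀ k : ℤ,
      rootValue j l k (rho n) ≠ 0 := by
    intro j l h1 h2 k h
    obtain ⟨h3, h4⟩ := rho_sub_bounds h1 h2
    unfold rootValue at h
    rcases le_or_gt k 0 with hk | hk
    · have : (2 * (n : ℤ) - 2) * k ≤ 0 := mul_nonpos_of_nonneg_of_nonpos (by linarith) hk
      linarith
    · have : (2 * (n : ℤ) - 2) * 1 ≤ (2 * (n : ℤ) - 2) * k :=
        mul_le_mul_of_nonneg_left hk (by linarith)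
      linarith
  rcases lt_or_gt_of_ne h1 with h3 | h3
  · exact key h3 h2 k
  · have := key h3 (fun h => h2 (by rw [h, Fin.rev_rev])) (-k)
    unfold rootValue at this ⊢
    intro h
    apply this
    linear_combination -h

theorem rootValue_ne_zero {j l : Fin (2 * n)} (h1 : j ≠ l) (h2 : j ≠ Fin.rev l) (k : ℤ)
    (w : IwahoriWeyl n) : rootValue j l k (scaledPoint w) ≠ 0 := by
  rw [← mul_one w, rootValue_mul, scaledPoint_one]
  refine rootValue_rho_ne_zero (fun h => h1 (Equiv.injective _ h)) ?_ _
  rw [← starPerm_inv_rev]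
  exact fun h => h2 (Equiv.injective _ h)

theorem embed_act_basePoint (hn : 2 ≤ n) (w : IwahoriWeyl n) (j l : Fin (2 * n)) (k : ℤ) :
    embed (act w (basePoint n)) j - embed (act w (basePoint n)) l - k =
      (rootValue j l k (scaledPoint w) : ℤ) / (2 * n - 2 : ℝ) := by
  have hM := two_mul_sub_two_pos hn
  rw [embed_act, embed_act, embed_basePoint, embed_basePoint, rootValue, embed_scaledPoint,
    embed_scaledPoint]
  push_cast
  generalize (2 * (n : ℝ) - 2) = M at *
  field_simp

/-! ### Generation by simple reflections -/

/-- The affine simple roots, weighted by their marks, add up to the constant `h`, which is also the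
sum of the marks. Values all at least `1` must therefore all equal `1`, as they do at `ρ`. -/
theorem eq_rho_of_rootValue_pos (hn : 2 ≤ n) {p : Fin n → ℤ}
    (h : ∀ j l : Fin (2 * n), j ≠ l → j ≠ Fin.rev l → ∀ k : ℤ, rootValue j l k (rho n) = 1 →
      1 ≤ rootValue j l k p) : p = rho n := by
  have hstep : ∀ i j : Fin n, (i : ℕ) + 1 = j → p j + 1 ≤ p i := by
    intro i j hij
    have := h (low i) (low j) (fun he => by rw [low_injective he] at hij; omega)
      (low_ne_rev_low i j) 0 (by simp only [rootValue, embed_low, rho]; omega)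
    simp only [rootValue, embed_low] at this
    linarith
  have hchain : ∀ d : ℕ, ∀ i j : Fin n, (j : ℕ) = i + d → p j + d ≤ p i := by
    intro d
    induction d with
    | zero => intro i j hij; rw [show i = j from Fin.ext hij.symm]; simp
    | succ d ih =>
      intro i j hij
      have h1 := ih i ⟨i + d, by omega⟩ rfl
      have h2 := hstep ⟨i + d, by omega⟩ j (by simp only; omega)
      push_cast
      linarith
  have hlast : 1 ≤ p ⟨n - 2, by omega⟩ + p ⟨n - 1, by omega⟩ := by
    have := h (low ⟨n - 2, by omega⟩) (Fin.rev (low ⟨n - 1, by omega⟩)) (low_ne_rev_low _ _)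
      (fun he => by
        rw [Fin.rev_rev] at he
        have := Fin.mk.inj (low_injective he)
        omega) 0 (by simp only [rootValue, embed_rev, embed_low, rho]; omega)
    simp only [rootValue, embed_rev, embed_low] at this
    linarith
  have haff : p ⟨0, by omega⟩ + p ⟨1, by omega⟩ ≤ 2 * n - 3 := by
    have := h (Fin.rev (low ⟨1, by omega⟩)) (low ⟨0, by omega⟩) (low_ne_rev_low _ _).symm
      (fun he => by
        have := Fin.mk.inj (low_injective (Fin.rev_injective he))
        omega) (-1) (by simp only [rootValue, embed_rev, embed_low, rho]; omega)
    simp only [rootValue, embed_rev, embed_low] at this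
    linarith
  have h01 := hstep ⟨0, by omega⟩ ⟨1, by omega⟩ rfl
  have hvals : p ⟨1, by omega⟩ = n - 2 ∧ p ⟨n - 1, by omega⟩ = 0 ∧ p ⟨0, by omega⟩ = n - 1 := by
    rcases hn.eq_or_lt with h2 | h3
    -- The root system is reducible for `n = 2`, with a second affine wall `x₁ - x₂ = 1`; its
    -- inequality is needed as well.
    · subst h2
      have := h (low ⟨1, by omega⟩) (low ⟨0, by omega⟩) (fun he => by
        have := Fin.mk.inj (low_injective he)
        omega) (low_ne_rev_low _ _) (-1) (by simp only [rootValue, embed_low, rho]; omega)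
      simp only [rootValue, embed_low] at this
      simp only [Nat.sub_self, Nat.reduceSub] at *
      push_cast at *
      omega
    · have h1 := hchain (n - 2) ⟨1, by omega⟩ ⟨n - 1, by omega⟩ (by simp only; omega)
      have h2 := hchain (n - 3) ⟨1, by omega⟩ ⟨n - 2, by omega⟩ (by simp only; omega)
      omega
  funext i
  rcases Nat.eq_zero_or_pos (i : ℕ) with hi | hi
  · rw [show i = ⟨0, by omega⟩ from Fin.ext hi, hvals.2.2]
    simp [rho]
  · have h1 := hchain (i - 1) ⟨1, by omega⟩ i (by simp only; omega)
    have h2 := hchain (n - 1 - i) i ⟨n - 1, by omega⟩ (by simp only; omega)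
    simp only [rho]
    omega

/-- In `σρ + hν = ρ` all entries of `ρ` are at most `n - 1 = h/2` in absolute value, with equality
only in the first place. So only `ν₁` can be nonzero, and evenness of the sum excludes `ν₁ = ±1`.
Then `σ` fixes `ρ`, whose last entry is `0`: the only nontrivial candidate changes the sign of the
last coordinate, and it is an odd permutation. -/
theorem eq_one_of_scaledPoint_eq (hn : 2 ≤ n) {w : IwahoriWeyl n} (hw : w ∈ affineWeyl n)
    (h : scaledPoint w = rho n) : w = 1 := by
  obtain ⟨heven, hsign⟩ := hw
  set σ : Equiv.Perm (Fin (2 * n)) := (linPart w).1 with hσ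
  have h' : ∀ m, embed (rho n) (σ⁻¹ m) + (2 * n - 2) * embed (transVec w) m =
      embed (rho n) m := fun m => by rw [← embed_scaledPoint, h]
  have hb : ∀ m : Fin (2 * n), -((n : ℤ) - 1) ≤ embed (rho n) m ∧
      embed (rho n) m ≤ (n : ℤ) - 1 := by
    intro m
    rw [embed_rho]
    have := m.2
    split_ifs <;> omega
  have habs : ∀ m, -1 ≤ embed (transVec w) m ∧ embed (transVec w) m ≤ 1 := by
    intro m
    have h1 := hb m
    have h2 := hb (σ⁻¹ m)
    have h3 := h' m
    constructor <;> by_contra hcon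
    · have : (2 * (n : ℤ) - 2) * embed (transVec w) m ≤ (2 * (n : ℤ) - 2) * (-2) :=
        mul_le_mul_of_nonneg_left (by omega) (by omega)
      linarith
    · have : (2 * (n : ℤ) - 2) * 2 ≤ (2 * (n : ℤ) - 2) * embed (transVec w) m :=
        mul_le_mul_of_nonneg_left (by omega) (by omega)
      linarith
  have hzero : ∀ i : Fin n, (i : ℕ) ≠ 0 → transVec w i = 0 := by
    intro i hi
    have h1 := habs (low i)
    have h2 := h' (low i)
    have h3 := hb (σ⁻¹ (low i))
    rw [embed_low] at h1 h2
    rw [embed_low, rho] at h2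
    rcases (by omega : transVec w i = -1 ∨ transVec w i = 0 ∨ transVec w i = 1) with e | e | e
    · rw [e] at h2; omega
    · exact e
    · rw [e] at h2; omega
  have hv : transVec w = 0 := by
    funext i
    by_cases hi : (i : ℕ) = 0
    · have hsum : ∑ k, transVec w k = transVec w i := by
        refine Finset.sum_eq_single i (fun k _ hk => hzero k fun h0 => hk (Fin.ext ?_)) (by simp)
        rw [h0, hi]
      rw [hsum] at heven
      have h1 := habs (low i)
      rw [embed_low] at h1
      obtain ⟨r, hr⟩ := heven
      simp only [Pi.zero_apply]
      omega
    · exact hzero i hi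
  have hfix : ∀ m : Fin (2 * n), embed (rho n) (σ⁻¹ m) = embed (rho n) m := by
    intro m
    have := h' m
    have hz : embed (0 : Fin n → ℤ) m = 0 := by unfold embed; split_ifs <;> simp
    rwa [hv, hz, mul_zero, add_zero] at this
  have hcases : ∀ m : Fin (2 * n), σ⁻¹ m = m ∨
      ((m : ℕ) = n - 1 ∨ (m : ℕ) = n) ∧ (((σ⁻¹ m : Fin (2 * n)) : ℕ) = n - 1 ∨
        ((σ⁻¹ m : Fin (2 * n)) : ℕ) = n) := by
    intro m
    have := hfix m
    rw [embed_rho, embed_rho] at this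
    have h1 := m.2
    have h2 := (σ⁻¹ m).2
    rw [Fin.ext_iff]
    split_ifs at this <;> omega
  refine iwahoriWeyl_ext hv (Subtype.ext ?_)
  change σ = 1
  by_contra hne
  have hswap : σ⁻¹ = Equiv.swap ⟨n - 1, by omega⟩ ⟨n, by omega⟩ := by
    have hex : ∃ m, σ⁻¹ m ≠ m := by
      by_contra hcon
      push Not at hcon
      exact hne (inv_eq_one.1 (Equiv.ext hcon))
    have hboth : σ⁻¹ ⟨n - 1, by omega⟩ = ⟨n, by omega⟩ ∧ σ⁻¹ ⟨n, by omega⟩ = ⟨n - 1, by omega⟩ := by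
      obtain ⟨m, hm⟩ := hex
      have hinj := (Equiv.injective σ⁻¹)
      have c1 := hcases ⟨n - 1, by omega⟩
      have c2 := hcases ⟨n, by omega⟩
      have c3 := (hcases m).resolve_left hm
      have hne1 : σ⁻¹ ⟨n - 1, by omega⟩ ≠ σ⁻¹ ⟨n, by omega⟩ := fun he => by
        have := Fin.mk.inj (hinj he)
        omega
      have hm1 : m = ⟨n - 1, by omega⟩ ∨ m = ⟨n, by omega⟩ := by
        rcases c3.1 with e | e
        · exact Or.inl (Fin.ext e)
        · exact Or.inr (Fin.ext e)
      simp only [Fin.ext_iff, Ne] at *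
      rcases hm1 with e | e
      · rw [show m = ⟨n - 1, by omega⟩ from Fin.ext e] at hm c3
        simp only at hm c3
        omega
      · rw [show m = ⟨n, by omega⟩ from Fin.ext e] at hm c3
        simp only at hm c3
        omega
    ext1 m
    rw [Equiv.swap_apply_def]
    split_ifs with e1 e2
    · rw [e1, hboth.1]
    · rw [e2, hboth.2]
    · refine (hcases m).resolve_right fun hc => ?_
      rcases hc.1 with e | e
      · exact e1 (Fin.ext e)
      · exact e2 (Fin.ext e)
  have hs : Equiv.Perm.sign σ = 1 := hsign
  rw [← inv_inv σ, hswap, Equiv.Perm.sign_inv, Equiv.Perm.sign_swap] at hs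
  · exact absurd hs (by decide)
  · intro he
    have := Fin.mk.inj he
    omega

theorem sum_root_mul (j l : Fin (2 * n)) (x : Fin n → ℤ) :
    ∑ i, (letterVec j - letterVec l) i * x i = embed x j - embed x l := by
  simp only [Pi.sub_apply, sub_mul, Finset.sum_sub_distrib]
  have h1 := sum_letterVec_mul (R := ℤ) j x
  have h2 := sum_letterVec_mul (R := ℤ) l x
  rw [← h1, ← h2]
  rfl

/-- Unless `y` fixes the base point, some wall has the base point and its image under `y` on
different sides; reflecting in it brings the image strictly closer. Squared distances in the scaled
lattice are natural numbers, so this terminates. -/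
theorem exists_word (hn : 2 ≤ n) (y : affineWeyl n) :
    ∃ L : List (affineWeyl n), (∀ s ∈ L, s ∈ simpleReflections n) ∧ L.prod = y := by
  induction hN : (∑ i, (scaledPoint (y : IwahoriWeyl n) i - rho n i) ^ 2).toNat
    using Nat.strong_induction_on generalizing y with
  | _ N ih =>
    by_cases hy : scaledPoint (y : IwahoriWeyl n) = rho n
    · refine ⟨[], by simp, ?_⟩
      exact (Subtype.ext (eq_one_of_scaledPoint_eq hn y.2 hy)).symm
    have hex := mt (eq_rho_of_rootValue_pos hn) hy
    push Not at hex
    obtain ⟨j, l, h1, h2, k, hk, hneg⟩ := hex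
    have hne := rootValue_ne_zero h1 h2 k (y : IwahoriWeyl n)
    set s : affineWeyl n := ⟨affRefl j l k, affRefl_mem h1 k⟩ with hs
    have hsS : s ∈ simpleReflections n := by
      refine affRefl_mem_simpleReflections hn h1 h2 ?_
      unfold rootValue at hk
      rw [hk, abs_one]
    have hss : s * s = 1 := Subtype.ext (affRefl_mul_self h1 h2 k)
    -- With `t` the root value at `p` and `1` its value at `ρ`, the squared distance changes by
    -- `-2t(t - 1) + 2t² = 2t`, which is negative.
    have hdec : ∑ i, (scaledPoint ((s * y : affineWeyl n) : IwahoriWeyl n) i - rho n i) ^ 2 =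
        ∑ i, (scaledPoint (y : IwahoriWeyl n) i - rho n i) ^ 2 +
          2 * rootValue j l k (scaledPoint (y : IwahoriWeyl n)) := by
      rw [Subgroup.coe_mul, show (s : IwahoriWeyl n) = affRefl j l k from rfl,
        scaledPoint_affRefl_mul h1 h2]
      set p := scaledPoint (y : IwahoriWeyl n)
      set t := rootValue j l k p with ht
      have e : ∀ i, ((p - t • (letterVec j - letterVec l)) i - rho n i) ^ 2 =
          (p i - rho n i) ^ 2 - 2 * t * ((letterVec j - letterVec l) i * (p - rho n) i) +
            t ^ 2 * ((letterVec j - letterVec l) i * (letterVec j - letterVec l) i) := by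
        intro i
        simp only [Pi.sub_apply, Pi.smul_apply, smul_eq_mul]
        ring
      simp only [e, Finset.sum_add_distrib, Finset.sum_sub_distrib, ← Finset.mul_sum,
        sum_root_mul]
      rw [embed_root_self h1 h2, embed_sub, embed_sub]
      unfold rootValue at hk ht
      linear_combination (2 * t) * hk + 2 * t * ht
    have hnn : 0 ≤ ∑ i, (scaledPoint ((s * y : affineWeyl n) : IwahoriWeyl n) i - rho n i) ^ 2 :=
      Finset.sum_nonneg fun _ _ => sq_nonneg _
    obtain ⟨L, hL, hprod⟩ := ih _ (by omega) (s * y) rfl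
    refine ⟨s :: L, ?_, ?_⟩
    · intro r hr
      rcases List.mem_cons.1 hr with rfl | hr
      · exact hsS
      · exact hL r hr
    · rw [List.prod_cons, hprod, ← mul_assoc, hss, one_mul]

/-! ### The strong exchange condition -/

/-- The word is a gallery from the base alcove to its image, so it crosses the hyperplane somewhere;
deleting the letter at the crossing multiplies the product by the reflection. The same argument
exhibits the reflection as a conjugate of that letter. -/
theorem strong_exchange_word (hn : 2 ≤ n) (L : List (affineWeyl n))
    (hL : ∀ s ∈ L, s ∈ simpleReflections n) {j l : Fin (2 * n)} (h1 : j ≠ l) (h2 : j ≠ Fin.rev l)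
    (k : ℤ) (hsep : rootValue j l k (rho n) *
      rootValue j l k (scaledPoint (L.prod : IwahoriWeyl n)) < 0) :
    (⟨affRefl j l k, affRefl_mem h1 k⟩ : affineWeyl n) ∈ reflections (simpleReflections n) ∧
      ∃ L' : List (affineWeyl n), (∀ s ∈ L', s ∈ simpleReflections n) ∧
        L'.prod = ⟨affRefl j l k, affRefl_mem h1 k⟩ * L.prod ∧ L'.length < L.length := by
  induction L generalizing j l k with
  | nil =>
    rw [List.prod_nil, Subgroup.coe_one, scaledPoint_one] at hsep
    exact absurd hsep (not_lt.2 (mul_self_nonneg _))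
  | cons s L ih =>
    have hs := hL s List.mem_cons_self
    have hL' : ∀ s ∈ L, s ∈ simpleReflections n := fun r hr => hL r (List.mem_cons_of_mem _ hr)
    rw [List.prod_cons, Subgroup.coe_mul] at hsep
    by_cases hc : rootValue j l k (rho n) * rootValue j l k (scaledPoint (s : IwahoriWeyl n)) < 0
    · have hst : (s : IwahoriWeyl n) = affRefl j l k := by
        apply eq_affRefl_of_separates hn hs h1 h2
        have e0 := embed_act_basePoint hn 1 j l k
        rw [act_one, scaledPoint_one] at e0
        rw [e0, embed_act_basePoint hn, div_mul_div_comm]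
        have hM := two_mul_sub_two_pos hn
        exact div_neg_of_neg_of_pos (by exact_mod_cast hc) (mul_pos hM hM)
      have hst' : (⟨affRefl j l k, affRefl_mem h1 k⟩ : affineWeyl n) = s := Subtype.ext hst.symm
      rw [hst']
      refine ⟨⟨1, s, hs, by simp⟩, L, hL', ?_, by simp⟩
      have hss : s * s = 1 := Subtype.ext (by
        rw [Subgroup.coe_mul, hst, affRefl_mul_self h1 h2]; rfl)
      rw [List.prod_cons, ← mul_assoc, hss, one_mul]
    -- The first letter does not cross the hyperplane. The hyperplane pulled back by `s` then
    -- separates the base point from its image under the rest of the word, so the induction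
    -- hypothesis applies to it.
    · set σ : Equiv.Perm (Fin (2 * n)) := (linPart (s : IwahoriWeyl n)).1 with hσ
      have h1' : σ⁻¹ j ≠ σ⁻¹ l := fun h => h1 (Equiv.injective _ h)
      have h2' : σ⁻¹ j ≠ Fin.rev (σ⁻¹ l) := by
        rw [hσ, ← starPerm_inv_rev]
        exact fun h => h2 (Equiv.injective _ h)
      set k' := k - embed (transVec (s : IwahoriWeyl n)) j + embed (transVec (s : IwahoriWeyl n)) l
        with hk'
      have hs0 := rootValue_ne_zero h1 h2 k (s : IwahoriWeyl n)
      have hr0 := rootValue_rho_ne_zero h1 h2 k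
      have hpos : 0 < rootValue j l k (rho n) *
          rootValue j l k (scaledPoint (s : IwahoriWeyl n)) :=
        lt_of_le_of_ne (not_lt.1 hc) (mul_ne_zero hr0 hs0).symm
      have e1 : rootValue j l k (scaledPoint (s : IwahoriWeyl n)) =
          rootValue (σ⁻¹ j) (σ⁻¹ l) k' (rho n) := by
        rw [← mul_one (s : IwahoriWeyl n), rootValue_mul, scaledPoint_one]
      rw [rootValue_mul] at hsep
      rw [e1] at hpos
      have hsep' : rootValue (σ⁻¹ j) (σ⁻¹ l) k' (rho n) *
          rootValue (σ⁻¹ j) (σ⁻¹ l) k' (scaledPoint (L.prod : IwahoriWeyl n)) < 0 := by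
        by_contra hcon
        have hsq : 0 < rootValue j l k (rho n) ^ 2 := by positivity
        have := mul_nonneg hpos.le (not_lt.1 hcon)
        have h3 : 0 < rootValue (σ⁻¹ j) (σ⁻¹ l) k' (rho n) ^ 2 := by
          have := right_ne_zero_of_mul hpos.ne'
          positivity
        have h4 := mul_neg_of_neg_of_pos hsep h3
        nlinarith
      obtain ⟨⟨g, r, hr, hgr⟩, L', hL'', hprod, hlen⟩ := ih hL' h1' h2' k' hsep'
      have hconj : s * ⟨affRefl (σ⁻¹ j) (σ⁻¹ l) k', affRefl_mem h1' k'⟩ =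
          (⟨affRefl j l k, affRefl_mem h1 k⟩ : affineWeyl n) * s := by
        apply Subtype.ext
        rw [Subgroup.coe_mul, Subgroup.coe_mul]
        have := mul_affRefl (s : IwahoriWeyl n) h1' h2' k' (j' := j) (l' := l)
          (by rw [← hσ]; simp) (by rw [← hσ]; simp)
        rw [this, hk']
        congr 2
        ring
      refine ⟨⟨s * g, r, hr, ?_⟩, s :: L', ?_, ?_, ?_⟩
      · rw [hgr] at hconj
        rw [mul_inv_rev, eq_comm, ← mul_assoc, mul_inv_eq_iff_eq_mul, ← hconj]
        group
      · intro r hr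
        rcases List.mem_cons.1 hr with rfl | hr
        · exact hs
        · exact hL'' r hr
      · rw [List.prod_cons, List.prod_cons, hprod, ← mul_assoc, ← mul_assoc, hconj]
      · simpa using hlen

theorem wordLength_affRefl_mul_lt (hn : 2 ≤ n) (y : affineWeyl n) {j l : Fin (2 * n)}
    (h1 : j ≠ l) (h2 : j ≠ Fin.rev l) (k : ℤ) (hsep : rootValue j l k (rho n) *
      rootValue j l k (scaledPoint (y : IwahoriWeyl n)) < 0) :
    (⟨affRefl j l k, affRefl_mem h1 k⟩ : affineWeyl n) ∈ reflections (simpleReflections n) ∧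
      wordLength (simpleReflections n) (⟨affRefl j l k, affRefl_mem h1 k⟩ * y) <
        wordLength (simpleReflections n) y := by
  obtain ⟨L, hL, hprod, hlen⟩ : wordLength (simpleReflections n) y ∈ {k : ℕ | ∃ l : List (affineWeyl n),
      (∀ s ∈ l, s ∈ simpleReflections n) ∧ l.prod = y ∧ l.length = k} := by
    obtain ⟨L, hL, hprod⟩ := exists_word hn y
    exact Nat.sInf_mem ⟨L.length, L, hL, hprod, rfl⟩
  rw [← hprod] at hsep
  obtain ⟨hr, L', hL', hprod', hlen'⟩ := strong_exchange_word hn L hL h1 h2 k hsep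
  refine ⟨hr, ?_⟩
  rw [← hlen]
  refine lt_of_le_of_lt (Nat.sInf_le ⟨L', hL', ?_, rfl⟩) hlen'
  rw [hprod', hprod]

/-- Reflecting in an affine root that has the same sign on the base alcove and its image under `x`
goes up in the Bruhat order. -/
theorem coxeterBruhat_step (hn : 2 ≤ n) (x : affineWeyl n) {j l : Fin (2 * n)}
    (h1 : j ≠ l) (h2 : j ≠ Fin.rev l) (k : ℤ) (hsame : 0 < rootValue j l k (rho n) *
      rootValue j l k (scaledPoint (x : IwahoriWeyl n))) :
    CoxeterBruhatLE (simpleReflections n) x (⟨affRefl j l k, affRefl_mem h1 k⟩ * x) ∧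
      wordLength (simpleReflections n) x <
        wordLength (simpleReflections n) (⟨affRefl j l k, affRefl_mem h1 k⟩ * x) := by
  have htt : (⟨affRefl j l k, affRefl_mem h1 k⟩ : affineWeyl n) *
      ⟨affRefl j l k, affRefl_mem h1 k⟩ = 1 := Subtype.ext (affRefl_mul_self h1 h2 k)
  have h := wordLength_affRefl_mul_lt hn (⟨affRefl j l k, affRefl_mem h1 k⟩ * x) h1 h2 k (by
    rw [Subgroup.coe_mul, rootValue_affRefl_mul h1 h2]
    linarith)
  rw [← mul_assoc, htt, one_mul] at h
  exact ⟨Relation.ReflTransGen.single ⟨_, h.1, rfl, h.2⟩, h.2⟩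

/-! ### Sign of signed permutations -/

/-- Such a permutation acts on the two halves of the letters by two copies of one permutation, so
its sign is a square. -/
theorem sign_eq_one_of_preserves_low {σ : Equiv.Perm (Fin (2 * n))}
    (hσ : ∀ i, σ (Fin.rev i) = Fin.rev (σ i)) (hlow : ∀ m : Fin (2 * n), (m : ℕ) < n →
      ((σ m : Fin (2 * n)) : ℕ) < n) : Equiv.Perm.sign σ = 1 := by
  let f : Fin n → Fin n := fun i => ⟨σ (low i), hlow (low i) i.2⟩
  have hf : ∀ i, low (f i) = σ (low i) := fun i => rfl
  have hinj : Function.Injective f := fun a b hab =>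
    low_injective (σ.injective (by rw [← hf, ← hf, hab]))
  let π : Equiv.Perm (Fin n) := Equiv.ofBijective f (Finite.injective_iff_bijective.1 hinj)
  let g : Fin n ⊕ Fin n → Fin (2 * n) := Sum.elim low fun i => Fin.rev (low i)
  have hg : Function.Bijective g := by
    constructor
    · rintro (a | a) (b | b) hab
      · exact congrArg _ (low_injective hab)
      · exact absurd hab (low_ne_rev_low a b)
      · exact absurd hab.symm (low_ne_rev_low b a)
      · exact congrArg _ (low_injective (Fin.rev_injective hab))
    · intro m
      rcases letter_cases m with ⟨i, rfl⟩ | ⟨i, rfl⟩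
      · exact ⟨Sum.inl i, rfl⟩
      · exact ⟨Sum.inr i, rfl⟩
  rw [← Equiv.Perm.sign_eq_sign_of_equiv (Equiv.sumCongr π π) σ (Equiv.ofBijective g hg)]
  · rw [show Equiv.sumCongr π π = Equiv.Perm.sumCongr π π from rfl, Equiv.Perm.sign_sumCongr]
    exact Int.units_mul_self _
  · rintro (a | a)
    · exact hf a
    · change Fin.rev (low (f a)) = σ (Fin.rev (low a))
      rw [hσ, hf]

/-! ### The vectors `(1, …, 1, 0, …, 0)` -/

/-- The vector with `k` entries equal to one, followed by zeros. -/
def initVec (n k : ℕ) : Fin n → ℤ := fun i => if (i : ℕ) < k then 1 else 0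

theorem embed_initVec {k : ℕ} (hk : k ≤ n) (l : Fin (2 * n)) : embed (initVec n k) l =
    if (l : ℕ) < k then 1 else if 2 * n ≤ (l : ℕ) + k then -1 else 0 := by
  have := l.2
  unfold embed initVec
  simp only
  split_ifs <;> omega

theorem embed_initVec_succ {k : ℕ} (hk : k < n) {l : Fin (2 * n)} (h1 : (l : ℕ) ≠ k)
    (h2 : (l : ℕ) + k + 1 ≠ 2 * n) : embed (initVec n (k + 1)) l = embed (initVec n k) l := by
  rw [embed_initVec hk, embed_initVec hk.le]
  split_ifs <;> omega

theorem neg_one_le_embed_initVec {k : ℕ} (hk : k ≤ n) (l : Fin (2 * n)) :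
    -1 ≤ embed (initVec n k) l := by
  rw [embed_initVec hk]
  split_ifs <;> omega

/-- The index `k` at which the entry of `f_k` becomes nonzero, with the sign of that entry,
determines the letter. -/
theorem eq_of_embed_initVec_eq {a b : Fin (2 * n)}
    (h : ∀ k ≤ n, embed (initVec n k) a = embed (initVec n k) b) : a = b := by
  have ha := a.2
  have hb := b.2
  apply Fin.ext
  by_cases han : (a : ℕ) < n
  · have h1 := h a han.le
    have h2 := h (a + 1) han
    rw [embed_initVec han.le, embed_initVec han.le] at h1
    rw [embed_initVec han, embed_initVec han] at h2
    split_ifs at h1 h2 <;> omega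
  · have hk : 2 * n - a ≤ n := by omega
    have hk' : 2 * n - 1 - a ≤ n := by omega
    have h1 := h _ hk
    have h2 := h _ hk'
    rw [embed_initVec hk, embed_initVec hk] at h1
    rw [embed_initVec hk', embed_initVec hk'] at h2
    split_ifs at h1 h2 <;> omega

/-! ### Permissibility at a vertex -/

/-- The letters other than `j` and `j*`. -/
def otherLetters (j : Fin (2 * n)) : Finset (Fin (2 * n)) :=
  Finset.univ.filter fun m => m ≠ j ∧ m ≠ Fin.rev j

theorem mem_otherLetters {j m : Fin (2 * n)} : m ∈ otherLetters j ↔ m ≠ j ∧ m ≠ Fin.rev j := by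
  simp [otherLetters]

theorem rev_mem_otherLetters {j m : Fin (2 * n)} (h : m ∈ otherLetters j) :
    Fin.rev m ∈ otherLetters j := by
  rw [mem_otherLetters] at *
  exact ⟨fun e => h.2 (by rw [← e, Fin.rev_rev]), fun e => h.1 (Fin.rev_injective e)⟩

/-- The condition `‖σ a + e_j - a‖₁ ≤ 1`, cleared of denominators, for `a` a small multiple of the
vector `(1, …, 1, 0, …, 0)`. -/
def VertexBound (j : Fin (2 * n)) (σ : starPerm n) (k : ℕ) : Prop :=
  ∑ m ∈ otherLetters j, |embed (permAct σ (initVec n k)) m - embed (initVec n k) m| ≤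
    2 * (embed (initVec n k) j - embed (permAct σ (initVec n k)) j)

theorem sum_otherLetters {j l : Fin (2 * n)} (hl : l ∈ otherLetters j) {h : Fin (2 * n) → ℤ}
    (heven : ∀ m, h (Fin.rev m) = h m) : ∑ m ∈ otherLetters j, h m =
      ∑ m ∈ ((otherLetters j).erase l).erase (Fin.rev l), h m + 2 * h l := by
  rw [← Finset.add_sum_erase _ h hl, ← Finset.add_sum_erase _ h
    (Finset.mem_erase.2 ⟨rev_ne_self l, rev_mem_otherLetters hl⟩), heven]
  ring

theorem abs_embed_sub_rev (x f : Fin n → ℤ) (m : Fin (2 * n)) :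
    |embed x (Fin.rev m) - embed f (Fin.rev m)| = |embed x m - embed f m| := by
  rw [embed_rev, embed_rev, ← abs_neg]
  congr 1
  ring

/-- Letters `m` and `m*` contribute equally, which cancels the factor `2`. The right-hand side is
the slack at `j`, shared by all other pairs of letters. -/
theorem VertexBound.abs_le {j : Fin (2 * n)} {σ : starPerm n} {k : ℕ} (h : VertexBound j σ k)
    {m : Fin (2 * n)} (hm : m ∈ otherLetters j) :
    |embed (permAct σ (initVec n k)) m - embed (initVec n k) m| ≤
      embed (initVec n k) j - embed (permAct σ (initVec n k)) j := by
  unfold VertexBound at h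
  rw [sum_otherLetters hm (abs_embed_sub_rev _ _)] at h
  have : 0 ≤ ∑ m ∈ ((otherLetters j).erase m).erase (Fin.rev m),
      |embed (permAct σ (initVec n k)) m - embed (initVec n k) m| :=
    Finset.sum_nonneg fun _ _ => abs_nonneg _
  linarith

theorem VertexBound.abs_add_abs_le {j : Fin (2 * n)} {σ : starPerm n} {k : ℕ}
    (h : VertexBound j σ k) {m m' : Fin (2 * n)} (hm : m ∈ otherLetters j)
    (hm' : m' ∈ otherLetters j) (h1 : m' ≠ m) (h2 : m' ≠ Fin.rev m) :
    |embed (permAct σ (initVec n k)) m - embed (initVec n k) m| +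
      |embed (permAct σ (initVec n k)) m' - embed (initVec n k) m'| ≤
      embed (initVec n k) j - embed (permAct σ (initVec n k)) j := by
  unfold VertexBound at h
  have h3 : Fin.rev m' ≠ m := fun e => h2 (by rw [← e, Fin.rev_rev])
  have h4 : Fin.rev m' ≠ Fin.rev m := fun e => h1 (Fin.rev_injective e)
  rw [sum_otherLetters hm (abs_embed_sub_rev _ _), ← Finset.add_sum_erase _ _
      (Finset.mem_erase.2 ⟨h2, Finset.mem_erase.2 ⟨h1, hm'⟩⟩), ← Finset.add_sum_erase _ _
      (Finset.mem_erase.2 ⟨rev_ne_self m', Finset.mem_erase.2 ⟨h4, Finset.mem_erase.2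
        ⟨h3, rev_mem_otherLetters hm'⟩⟩⟩), abs_embed_sub_rev] at h
  have : 0 ≤ ∑ m ∈ ((((otherLetters j).erase m).erase (Fin.rev m)).erase m').erase (Fin.rev m'),
      |embed (permAct σ (initVec n k)) m - embed (initVec n k) m| :=
    Finset.sum_nonneg fun _ _ => abs_nonneg _
  linarith

theorem VertexBound.le {j : Fin (2 * n)} {σ : starPerm n} {k : ℕ} (h : VertexBound j σ k) :
    embed (permAct σ (initVec n k)) j ≤ embed (initVec n k) j := by
  unfold VertexBound at h
  have : 0 ≤ ∑ m ∈ otherLetters j, |embed (permAct σ (initVec n k)) m - embed (initVec n k) m| :=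
    Finset.sum_nonneg fun _ _ => abs_nonneg _
  linarith

theorem VertexBound.eq_of_eq {j : Fin (2 * n)} {σ : starPerm n} {k : ℕ} (h : VertexBound j σ k)
    (hj : embed (permAct σ (initVec n k)) j = embed (initVec n k) j)
    {m : Fin (2 * n)} (hm : m ∈ otherLetters j) :
    embed (permAct σ (initVec n k)) m = embed (initVec n k) m := by
  have := h.abs_le hm
  rw [hj, sub_self] at this
  exact sub_eq_zero.1 (abs_nonpos_iff.1 this)

theorem vertexBound_weylRefl_mul {j l : Fin (2 * n)} (hl : l ∈ otherLetters j) {σ : starPerm n}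
    {k : ℕ} (h : ∑ m ∈ ((otherLetters j).erase l).erase (Fin.rev l),
        |embed (permAct σ (initVec n k)) m - embed (initVec n k) m| +
      2 * |embed (permAct σ (initVec n k)) j - embed (initVec n k) l| ≤
        2 * (embed (initVec n k) j - embed (permAct σ (initVec n k)) l)) :
    VertexBound j (weylRefl j l * σ) k := by
  obtain ⟨h1, h2⟩ := mem_otherLetters.1 hl
  have h2' : j ≠ Fin.rev l := fun e => h2 (by rw [e, Fin.rev_rev])
  have hinv : (weylRefl j l : Equiv.Perm (Fin (2 * n)))⁻¹ = weylRefl j l :=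
    congrArg Subtype.val (weylRefl_inv j l)
  unfold VertexBound
  rw [sum_otherLetters hl (abs_embed_sub_rev _ _), permAct_mul]
  simp only [embed_permAct (weylRefl j l), hinv, weylRefl_apply h1.symm h2', if_true, if_neg h1]
  refine le_trans (le_of_eq ?_) h
  congr 1
  refine Finset.sum_congr rfl fun m hm => ?_
  simp only [Finset.mem_erase, mem_otherLetters] at hm
  rw [if_neg hm.2.2.1, if_neg hm.2.1, if_neg hm.2.2.2, if_neg hm.1]

/-- The reflection exchanges the entries of `σ f_k` at `j` and `l`. If the entry arriving at `l` is
at least that of `f_k`, the new discrepancy at `l` is paid for by the change of the drop at `j`. -/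
theorem VertexBound.weylRefl_mul {j l : Fin (2 * n)} (hl : l ∈ otherLetters j) {σ : starPerm n}
    {k : ℕ} (h : VertexBound j σ k)
    (hle : embed (initVec n k) l ≤ embed (permAct σ (initVec n k)) j) :
    VertexBound j (weylRefl j l * σ) k := by
  apply vertexBound_weylRefl_mul hl
  unfold VertexBound at h
  rw [sum_otherLetters hl (abs_embed_sub_rev _ _)] at h
  rw [abs_of_nonneg (sub_nonneg.2 hle)]
  have := le_abs_self (embed (permAct σ (initVec n k)) l - embed (initVec n k) l)
  linarith

/-- `σ` maps `(1, …, 1, 0, …, 0)`, with the entry at the letter `j` equal to one, to the vector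
which differs from it only in the sign of this entry. -/
def FlipsAt (j : Fin (2 * n)) (σ : starPerm n) (k : ℕ) : Prop :=
  embed (initVec n k) j = 1 ∧ embed (permAct σ (initVec n k)) j = -1 ∧
    ∀ m ∈ otherLetters j, embed (permAct σ (initVec n k)) m = embed (initVec n k) m

/-- Appending a one in a place fixed by `σ` alters `f_k` and `σ f_k` in the same way. -/
theorem FlipsAt.succ {j : Fin (2 * n)} {σ : starPerm n} {k : ℕ} (h : FlipsAt j σ k) (hk : k < n)
    (hfix : (σ : Equiv.Perm (Fin (2 * n)))⁻¹ (low ⟨k, hk⟩) = low ⟨k, hk⟩) :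
    FlipsAt j σ (k + 1) := by
  obtain ⟨h1, h2, h3⟩ := h
  simp only [FlipsAt, embed_permAct] at *
  set τ := (σ : Equiv.Perm (Fin (2 * n)))⁻¹ with hτ
  have hfix' : τ (Fin.rev (low ⟨k, hk⟩)) = Fin.rev (low ⟨k, hk⟩) := by
    rw [hτ, starPerm_inv_rev, ← hτ, hfix]
  have hval : ∀ m : Fin (2 * n), (m : ℕ) = k ↔ m = low ⟨k, hk⟩ := fun m =>
    (Fin.ext_iff (b := low ⟨k, hk⟩)).symm
  have hval' : ∀ m : Fin (2 * n), (m : ℕ) + k + 1 = 2 * n ↔ m = Fin.rev (low ⟨k, hk⟩) := by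
    intro m
    rw [Fin.ext_iff, Fin.val_rev]
    simp only [low]
    omega
  have key : ∀ m : Fin (2 * n), m ≠ low ⟨k, hk⟩ → m ≠ Fin.rev (low ⟨k, hk⟩) →
      embed (initVec n (k + 1)) m = embed (initVec n k) m ∧
        embed (initVec n (k + 1)) (τ m) = embed (initVec n k) (τ m) := by
    intro m e1 e2
    have e3 : τ m ≠ low ⟨k, hk⟩ := fun e => e1 (τ.injective (e.trans hfix.symm))
    have e4 : τ m ≠ Fin.rev (low ⟨k, hk⟩) := fun e => e2 (τ.injective (e.trans hfix'.symm))
    exact ⟨embed_initVec_succ hk (by rwa [Ne, hval]) (by rwa [Ne, hval']),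
      embed_initVec_succ hk (by rwa [Ne, hval]) (by rwa [Ne, hval'])⟩
  have hj : (j : ℕ) < k := by
    rw [embed_initVec hk.le] at h1
    split_ifs at h1 <;> omega
  have hjk := key j (by rw [Ne, ← hval]; omega) (by rw [Ne, ← hval']; omega)
  refine ⟨by rw [hjk.1, h1], by rw [hjk.2, h2], fun m hm => ?_⟩
  by_cases e1 : m = low ⟨k, hk⟩
  · rw [e1, hfix]
  by_cases e2 : m = Fin.rev (low ⟨k, hk⟩)
  · rw [e2, hfix']
  rw [(key m e1 e2).1, (key m e1 e2).2, h3 m hm]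

/-- At `k = n` the vector `f_n` tells the two halves of the letters apart. So `σ`, corrected by the
transposition of `j` and `j*`, preserves the lower half and is even, which makes `σ` odd. -/
theorem not_isEven_of_flipsAt {j : Fin (2 * n)} {σ : starPerm n} (h : FlipsAt j σ n) :
    ¬ IsEven σ := by
  obtain ⟨h1, h2, h3⟩ := h
  intro hs
  simp only [embed_permAct] at h2 h3
  have hval : ∀ m : Fin (2 * n), embed (initVec n n) m = if (m : ℕ) < n then 1 else -1 := by
    intro m
    rw [embed_initVec le_rfl]
    split_ifs <;> omega
  have hsign : Equiv.Perm.sign (Equiv.swap j (Fin.rev j) * (σ : Equiv.Perm (Fin (2 * n)))) = 1 := by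
    rw [← Equiv.Perm.sign_inv]
    apply sign_eq_one_of_preserves_low
    · intro i
      rw [mul_inv_rev, Equiv.swap_inv, Equiv.Perm.mul_apply, Equiv.Perm.mul_apply,
        ← starPerm_inv_rev]
      congr 1
      have := rev_ne_self j
      simp only [Equiv.swap_apply_def]
      grind [Fin.rev_rev]
    · intro m hm
      rw [mul_inv_rev, Equiv.swap_inv, Equiv.Perm.mul_apply]
      rw [hval] at h1 h2
      have hj : (j : ℕ) < n := by
        by_contra hc; rw [if_neg hc] at h1; omega
      have hm' : m ≠ Fin.rev j := by
        rintro rfl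
        rw [Fin.val_rev] at hm
        omega
      by_cases e : m = j
      · rw [e, Equiv.swap_apply_left, starPerm_inv_rev, Fin.val_rev]
        split_ifs at h2
        omega
      · rw [Equiv.swap_apply_of_ne_of_ne e hm']
        have := h3 m (mem_otherLetters.2 ⟨e, hm'⟩)
        rw [hval, hval, if_pos hm] at this
        by_contra hc
        rw [if_neg hc] at this
        omega
  rw [Equiv.Perm.sign_mul, Equiv.Perm.sign_swap (rev_ne_self j).symm,
    show Equiv.Perm.sign (σ : Equiv.Perm (Fin (2 * n))) = 1 from hs] at hsign
  exact absurd hsign (by decide)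

/-- An element that satisfies the vertex conditions and sends `j*` to a letter at which the first
kind of step is not available changes the sign of the entry at `j`. -/
theorem flipsAt_of_vertexBound {j : Fin (2 * n)} {σ : starPerm n}
    (hV : ∀ k ≤ n, VertexBound j σ k) (hj : (σ : Equiv.Perm (Fin (2 * n)))⁻¹ j ≠ j)
    {p : Fin (2 * n)} (hpn : (p : ℕ) < n)
    (hp : (σ : Equiv.Perm (Fin (2 * n)))⁻¹ j = Fin.rev p)
    (hstep : j ≠ p → embed (rho n) p ≤ embed (rho n) ((σ : Equiv.Perm (Fin (2 * n)))⁻¹ p)) :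
    FlipsAt j σ (p + 1) := by
  have hVp := hV p hpn.le
  have hVp2 := fun m m' => hVp.abs_add_abs_le (m := m) (m' := m')
  have hVp1 := fun m => hVp.abs_le (m := m)
  have hVp0 := fun m => hVp.eq_of_eq (m := m)
  simp only [FlipsAt, embed_permAct] at *
  set τ := (σ : Equiv.Perm (Fin (2 * n)))⁻¹ with hτ
  have hrp : ((Fin.rev p : Fin (2 * n)) : ℕ) = 2 * n - (p + 1) := Fin.val_rev p
  have hjr : τ (Fin.rev j) = p := by rw [hτ, starPerm_inv_rev, ← hτ, hp, Fin.rev_rev]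
  have hsucc : ∀ m : Fin (2 * n), m ≠ p → m ≠ Fin.rev p →
      embed (initVec n (p + 1)) m = embed (initVec n p) m := by
    intro m e1 e2
    rw [Ne, Fin.ext_iff] at e1 e2
    exact embed_initVec_succ hpn e1 (by omega)
  have hpp : embed (initVec n p) p = 0 := by
    rw [embed_initVec hpn.le]; split_ifs <;> omega
  have hpr : embed (initVec n p) (Fin.rev p) = 0 := by rw [embed_rev, hpp, neg_zero]
  have hpp1 : embed (initVec n (p + 1)) p = 1 := by
    rw [embed_initVec hpn]; split_ifs <;> omega
  have hpr1 : embed (initVec n (p + 1)) (Fin.rev p) = -1 := by rw [embed_rev, hpp1]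
  have hτp : ∀ m ∈ otherLetters j, τ m ≠ p ∧ τ m ≠ Fin.rev p := by
    intro m hm
    rw [mem_otherLetters] at hm
    exact ⟨fun e => hm.2 (τ.injective (e.trans hjr.symm)),
      fun e => hm.1 (τ.injective (e.trans hp.symm))⟩
  by_cases hjp : j = p
  · refine ⟨by rw [hjp, hpp1], by rw [hp, hpr1], fun m hm => ?_⟩
    have hm' := mem_otherLetters.1 hm
    rw [hjp] at hm'
    rw [hsucc _ (hτp m hm).1 (hτp m hm).2, hsucc _ hm'.1 hm'.2]
    exact hVp0 m (by rw [hp, hpr, hjp, hpp]) hm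
  · have hpj : p ≠ Fin.rev j := fun e => hj (by rw [hp, e, Fin.rev_rev])
    have hpo : p ∈ otherLetters j := mem_otherLetters.2 ⟨fun e => hjp e.symm, hpj⟩
    have hq1 := (hτp p hpo).1
    have hq2 := (hτp p hpo).2
    have hq := hstep hjp
    -- Weak inequality of `ρ` values suffices because `τ p` is neither `p` nor `p*`.
    have hqp : ((τ p : Fin (2 * n)) : ℕ) < p := by
      rw [embed_rho, embed_rho, if_pos hpn] at hq
      rw [Ne, Fin.ext_iff] at hq1 hq2
      split_ifs at hq <;> omega
    have hqv : embed (initVec n p) (τ p) = 1 := by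
      rw [embed_initVec hpn.le, if_pos hqp]
    have hqv1 : embed (initVec n (p + 1)) (τ p) = 1 := by
      rw [embed_initVec hpn, if_pos (by omega)]
    -- At `k = p` the discrepancy at the letter `p` is `1`, while `σ f_p` vanishes at `j`. This
    -- forces the entry of `f_p` at `j` to be `1` and uses up all the slack, so `σ f_p` and `f_p`
    -- agree at the remaining letters.
    have h1 := hVp1 p hpo
    rw [hqv, hpp, hp, hpr, sub_zero, sub_zero, abs_one] at h1
    have hjv : embed (initVec n p) j = 1 := by
      rw [embed_initVec hpn.le] at h1 ⊢
      split_ifs at h1 ⊢ <;> omega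
    have hjrp : j ≠ Fin.rev p := fun e => hpj (by rw [e, Fin.rev_rev])
    refine ⟨by rw [hsucc j hjp hjrp, hjv], by rw [hp, hpr1], fun m hm => ?_⟩
    by_cases e1 : m = p
    · rw [e1, hqv1, hpp1]
    by_cases e2 : m = Fin.rev p
    · rw [e2, hτ, starPerm_inv_rev, ← hτ, embed_rev, hqv1, hpr1]
    have h2 := hVp2 p m hpo hm e1 e2
    rw [hqv, hpp, hp, hpr, hjv, sub_zero, abs_one] at h2
    rw [hsucc _ (hτp m hm).1 (hτp m hm).2, hsucc _ e1 e2]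
    exact sub_eq_zero.1 (abs_nonpos_iff.1 (by linarith))

/-- The reflecting letter is `r*`, where `r` is the first letter beyond `p` in the lower half that
`σ` moves. The flip at `j` persists for all `k` with `p < k ≤ r`, which is what the bounds for the
new element require. -/
theorem exists_step_of_flipsAt {j : Fin (2 * n)} {σ : starPerm n} (hσ : IsEven σ)
    (hV : ∀ k ≤ n, VertexBound j σ k) {p : Fin (2 * n)} (hpn : (p : ℕ) < n)
    (hp : (σ : Equiv.Perm (Fin (2 * n)))⁻¹ j = Fin.rev p) (hflip : FlipsAt j σ (p + 1)) :
    ∃ l ∈ otherLetters j, embed (rho n) ((σ : Equiv.Perm (Fin (2 * n)))⁻¹ j) <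
        embed (rho n) ((σ : Equiv.Perm (Fin (2 * n)))⁻¹ l) ∧
      ∀ k ≤ n, VertexBound j (weylRefl j l * σ) k := by
  classical
  set τ := (σ : Equiv.Perm (Fin (2 * n)))⁻¹ with hτ
  -- If all letters from `p + 1` to `n - 1` were fixed, the flip would persist up to `k = n` and `σ`
  -- would be odd.
  have hex : ∃ r, ∃ h : r < n, (p : ℕ) + 1 ≤ r ∧ τ (low ⟨r, h⟩) ≠ low ⟨r, h⟩ := by
    by_contra hcon
    push Not at hcon
    have hall : ∀ d, (p : ℕ) + 1 + d ≤ n → FlipsAt j σ (p + 1 + d) := by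
      intro d
      induction d with
      | zero => intro _; exact hflip
      | succ d ih =>
        intro hd
        exact (ih (by omega)).succ (by omega) (hcon _ _ (by omega))
    have := hall (n - (p + 1)) (by omega)
    rw [show (p : ℕ) + 1 + (n - (p + 1)) = n by omega] at this
    exact not_isEven_of_flipsAt this hσ
  obtain ⟨hrn, hpr, hrτ⟩ := Nat.find_spec hex
  set r := Nat.find hex with hr
  have hmin : ∀ r' < r, ∀ h : r' < n, (p : ℕ) + 1 ≤ r' → τ (low ⟨r', h⟩) = low ⟨r', h⟩ := by
    intro r' hr' h hpr'
    by_contra hc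
    exact Nat.find_min hex hr' ⟨h, hpr', hc⟩
  have hall : ∀ d, (p : ℕ) + 1 + d ≤ r → FlipsAt j σ (p + 1 + d) := by
    intro d
    induction d with
    | zero => intro _; exact hflip
    | succ d ih =>
      intro hd
      exact (ih (by omega)).succ (by omega) (hmin _ (by omega) _ (by omega))
  have hflips : ∀ k, (p : ℕ) < k → k ≤ r → FlipsAt j σ k := by
    intro k h1 h2
    have := hall (k - (p + 1)) (by omega)
    rwa [show (p : ℕ) + 1 + (k - (p + 1)) = k by omega] at this
  clear_value r
  set R : Fin (2 * n) := low ⟨r, hrn⟩ with hR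
  have hRval : (R : ℕ) = r := rfl
  have hRrev : ((Fin.rev R : Fin (2 * n)) : ℕ) = 2 * n - (r + 1) := by rw [Fin.val_rev, hRval]
  have hPrev : ((Fin.rev p : Fin (2 * n)) : ℕ) = 2 * n - (p + 1) := Fin.val_rev p
  have hjr : (j : ℕ) < p + 1 := by
    have := hflip.1
    rw [embed_initVec hpn] at this
    split_ifs at this <;> omega
  have hRo : R ∈ otherLetters j := by
    rw [mem_otherLetters, Ne, Ne, Fin.ext_iff, Fin.ext_iff, Fin.val_rev]
    omega
  have hRo' := rev_mem_otherLetters hRo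
  refine ⟨Fin.rev R, hRo', ?_, fun k hk => ?_⟩
  -- Since `σ f_r` agrees with `f_r` at `r`, where the entry is `0`, the letter `τ r` lies between
  -- `r` and `r*`; hence `ρ(τ r) ≤ ρ(r) < ρ(p)`.
  · have h := (hflips r (by omega) le_rfl).2.2 R hRo
    rw [embed_permAct, ← hτ, embed_initVec hrn.le, embed_initVec hrn.le] at h
    rw [hp, hτ, starPerm_inv_rev, ← hτ, embed_rev, embed_rev, neg_lt_neg_iff, embed_rho, embed_rho,
      if_pos hpn]
    have := (τ R).2
    split_ifs at h ⊢ <;> omega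
  · have hxj : embed (permAct σ (initVec n k)) j = embed (initVec n k) (Fin.rev p) := by
      rw [embed_permAct, ← hτ, hp]
    by_cases h1 : k ≤ p
    · refine (hV k hk).weylRefl_mul hRo' ?_
      rw [hxj, embed_initVec hk, embed_initVec hk]
      split_ifs <;> omega
    by_cases h2 : r < k
    · refine (hV k hk).weylRefl_mul hRo' ?_
      have h3 : embed (initVec n k) (Fin.rev R) = -1 := by
        rw [embed_initVec hk]
        split_ifs <;> omega
      rw [h3, hxj]
      exact neg_one_le_embed_initVec hk _
    -- In the middle range the sum over the remaining letters is zero, and the bound for the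
    -- reflected element holds with equality, `2 ≤ 2`.
    · obtain ⟨f1, f2, f3⟩ := hflips k (by omega) (by omega)
      have h3 : embed (initVec n k) (Fin.rev R) = 0 := by
        rw [embed_initVec hk]
        split_ifs <;> omega
      apply vertexBound_weylRefl_mul hRo'
      rw [f1, f2, f3 _ hRo', h3, Finset.sum_eq_zero]
      · norm_num
      · intro m hm
        rw [f3 m (Finset.mem_of_mem_erase (Finset.mem_of_mem_erase hm)), sub_self, abs_zero]

/-- A nontrivial element of `S°` that satisfies the vertex conditions can be moved towards the
identity by a reflection. -/
theorem exists_step {j : Fin (2 * n)} {σ : starPerm n} (hσ : IsEven σ)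
    (hV : ∀ k ≤ n, VertexBound j σ k) (hne : σ ≠ 1) :
    ∃ l ∈ otherLetters j, embed (rho n) ((σ : Equiv.Perm (Fin (2 * n)))⁻¹ j) <
        embed (rho n) ((σ : Equiv.Perm (Fin (2 * n)))⁻¹ l) ∧
      ∀ k ≤ n, VertexBound j (weylRefl j l * σ) k := by
  set τ := (σ : Equiv.Perm (Fin (2 * n)))⁻¹ with hτ
  -- If `j` is fixed there is no slack at any `k`, so `σ` fixes every `f_k` and is trivial.
  have hj : τ j ≠ j := by
    intro hj
    apply hne
    apply Subtype.ext
    change (σ : Equiv.Perm (Fin (2 * n))) = 1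
    rw [← inv_eq_one]
    ext1 m
    apply eq_of_embed_initVec_eq
    intro k hk
    by_cases e1 : m = j
    · rw [e1, ← hτ, hj]; rfl
    by_cases e2 : m = Fin.rev j
    · rw [e2, starPerm_inv_rev, ← hτ, hj]; rfl
    rw [← embed_permAct]
    exact (hV k hk).eq_of_eq (by rw [embed_permAct, ← hτ, hj]) (mem_otherLetters.2 ⟨e1, e2⟩)
  have hclose : ∀ k ≤ n, τ j ∈ otherLetters j → VertexBound j (weylRefl j (τ j) * σ) k := by
    intro k hk ho
    exact (hV k hk).weylRefl_mul ho (by rw [embed_permAct])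
  by_cases hl : ((τ j : Fin (2 * n)) : ℕ) < n
  -- For `k = τ j + 1` the entry of `σ f_k` at `j` is `1`, the largest possible, so there is no
  -- slack. Comparing entries at `τ j` puts `τ (τ j)` strictly before `τ j`, so the step with `l = τ
  -- j` goes up.
  · have hk := hV _ hl
    have e1 : embed (initVec n (τ j + 1)) (τ j) = 1 := by
      rw [embed_initVec hl, if_pos (Nat.lt_succ_self _)]
    have h1 := hk.le
    rw [embed_permAct, ← hτ, e1] at h1
    have e2 : embed (initVec n (τ j + 1)) j = 1 := by
      rw [embed_initVec hl] at h1 ⊢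
      split_ifs at h1 ⊢ <;> omega
    have ho : τ j ∈ otherLetters j := by
      refine mem_otherLetters.2 ⟨hj, fun e => ?_⟩
      rw [e, embed_rev, ← e, e2] at e1
      omega
    refine ⟨τ j, ho, ?_, fun k hk => hclose k hk ho⟩
    have e3 := hk.eq_of_eq (by rw [embed_permAct, ← hτ, e1, e2]) ho
    rw [embed_permAct, ← hτ, e1, embed_initVec hl] at e3
    have e4 : τ (τ j) ≠ τ j := fun e => hj (τ.injective e)
    rw [Ne, Fin.ext_iff] at e4
    rw [embed_rho, embed_rho, if_pos hl]
    split_ifs at e3 ⊢ <;> omega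
  · have hpn : ((Fin.rev (τ j) : Fin (2 * n)) : ℕ) < n := by rw [Fin.val_rev]; omega
    have hp : τ j = Fin.rev (Fin.rev (τ j)) := (Fin.rev_rev _).symm
    by_cases hc : j ≠ Fin.rev (τ j) ∧ embed (rho n) (τ j) < embed (rho n) (τ (τ j))
    · have ho : τ j ∈ otherLetters j :=
        mem_otherLetters.2 ⟨hj, fun e => hc.1 (by rw [e, Fin.rev_rev])⟩
      exact ⟨τ j, ho, hc.2, fun k hk => hclose k hk ho⟩
    · refine exists_step_of_flipsAt hσ hV hpn hp (flipsAt_of_vertexBound hV hj hpn hp fun hjp => ?_)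
      rw [starPerm_inv_rev, ← hτ, embed_rev, embed_rev]
      by_contra hlt
      exact hc ⟨hjp, by linarith⟩

/-! ### The stabilizer of the base alcove -/

theorem act_basePoint_of_scaledPoint_eq (hn : 2 ≤ n) {w : IwahoriWeyl n}
    (h : scaledPoint w = rho n) : act w (basePoint n) = basePoint n := by
  apply embed_ext
  intro m
  have hM := two_mul_sub_two_pos hn
  have hm := embed_scaledPoint w m
  rw [h] at hm
  rw [embed_act, embed_basePoint, embed_basePoint, hm]
  push_cast
  generalize (2 * (n : ℝ) - 2) = M at *
  field_simp

theorem scaledPoint_mul_of_eq {w' : IwahoriWeyl n} (h : scaledPoint w' = rho n)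
    (w : IwahoriWeyl n) : scaledPoint (w * w') = scaledPoint w := by
  rw [scaledPoint_mul, h]
  rfl

theorem scaledPoint_inv_of_eq {w : IwahoriWeyl n} (h : scaledPoint w = rho n) :
    scaledPoint w⁻¹ = rho n := by
  rw [← scaledPoint_mul_of_eq h, inv_mul_cancel, scaledPoint_one]

/-- An element fixing one interior point of the alcove preserves it: no affine root changes sign on
the alcove, so all signs at `act w x` agree with those at the base point. -/
theorem act_mem_baseAlcove_of_scaledPoint_eq (hn : 2 ≤ n) {w : IwahoriWeyl n}
    (h : scaledPoint w = rho n) {x : Fin n → ℝ} (hx : x ∈ baseAlcove n) :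
    act w x ∈ baseAlcove n := by
  refine mem_baseAlcove fun j l hjl hne => ?_
  have hb := sub_mem_Ioo_of_mem_baseAlcove (basePoint_mem hn) hjl hne
  have key : ∀ m : ℤ, 0 < (embed (basePoint n) j - embed (basePoint n) l - m) *
      (embed (act w x) j - embed (act w x) l - m) := by
    intro m
    have := mul_pos_of_mem_baseAlcove (basePoint_mem hn) hx
      (j := (linPart w : Equiv.Perm (Fin (2 * n)))⁻¹ j)
      (l := (linPart w : Equiv.Perm (Fin (2 * n)))⁻¹ l)
      (fun h => hjl.ne (Equiv.injective _ h))
      (by rw [← starPerm_inv_rev]; exact fun h => hne (Equiv.injective _ h))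
      (m - embed (transVec w) j + embed (transVec w) l)
    rw [← act_basePoint_of_scaledPoint_eq hn h]
    simp only [embed_act]
    push_cast at this
    refine lt_of_lt_of_eq this ?_
    ring
  have h0 := key 0
  have h1 := key 1
  rw [Int.cast_zero, sub_zero, sub_zero] at h0
  rw [Int.cast_one] at h1
  have h0' := (pos_iff_pos_of_mul_pos h0).1 hb.1
  have h1' := (neg_iff_neg_of_mul_pos h1).1 (by linarith)
  exact ⟨h0', by linarith⟩

theorem mem_Omega_of_scaledPoint_eq (hn : 2 ≤ n) {w : IwahoriWeyl n}
    (h : scaledPoint w = rho n) : w ∈ Omega n := by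
  apply Set.Subset.antisymm
  · rintro _ ⟨x, hx, rfl⟩
    exact act_mem_baseAlcove_of_scaledPoint_eq hn h hx
  · intro x hx
    refine ⟨act w⁻¹ x, act_mem_baseAlcove_of_scaledPoint_eq hn (scaledPoint_inv_of_eq h) hx, ?_⟩
    rw [← act_mul, mul_inv_cancel, act_one]

theorem even_sum_transVec_mul (w w' : IwahoriWeyl n) : Even (∑ i, transVec (w * w') i) ↔
    (Even (∑ i, transVec w i) ↔ Even (∑ i, transVec w' i)) := by
  rw [transVec_mul]
  simp only [Pi.add_apply, Finset.sum_add_distrib]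
  rw [Int.even_add, even_sum_permAct]

theorem isEven_mul {σ τ : starPerm n} (hσ : IsEven σ) (hτ : IsEven τ) : IsEven (σ * τ) := by
  unfold IsEven at *
  rw [Subgroup.coe_mul, Equiv.Perm.sign_mul, hσ, hτ, one_mul]

theorem isEven_inv {σ : starPerm n} (hσ : IsEven σ) : IsEven σ⁻¹ := by
  unfold IsEven at *
  rw [Subgroup.coe_inv, Equiv.Perm.sign_inv, hσ]

/-- The stabilizer of the base alcove contains an element with even linear part and odd
translation part, namely `x ↦ (1 - x₁, x₂, …, x_{n-1}, -x_n)`. -/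
theorem exists_odd_stabilizer (hn : 2 ≤ n) : ∃ w : IwahoriWeyl n, scaledPoint w = rho n ∧
    IsEven (linPart w) ∧ ¬ Even (∑ i, transVec w i) := by
  set a : Fin (2 * n) := low ⟨0, by omega⟩ with ha
  set b : Fin (2 * n) := low ⟨n - 1, by omega⟩ with hb
  have h1 : a ≠ b := fun h => by
    have := Fin.mk.inj (low_injective h)
    omega
  have h2 : a ≠ Fin.rev b := low_ne_rev_low _ _
  have h2' : Fin.rev b ≠ a := h2.symm
  have h3 : Fin.rev a ≠ b := fun h => h2 (by rw [← h, Fin.rev_rev])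
  refine ⟨⟨Multiplicative.ofAdd (letterVec a), weylRefl a b * weylRefl a (Fin.rev b)⟩, ?_,
    isEven_mul (isEven_weylRefl h1) (isEven_weylRefl h2), Int.not_even_iff_odd.2
      (odd_sum_letterVec a)⟩
  have hρa : embed (rho n) a = n - 1 := by rw [ha, embed_low]; simp [rho]
  have hρb : embed (rho n) b = 0 := by rw [hb, embed_low]; simp only [rho]; omega
  change permAct (weylRefl a b * weylRefl a (Fin.rev b)) (rho n) +
    (2 * (n : ℤ) - 2) • letterVec a = rho n
  rw [permAct_mul, permAct_weylRefl h2 (by rwa [Fin.rev_rev]), permAct_weylRefl h1 h2]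
  have hc : ∀ v : Fin n → ℤ, (fun i => ((v i : ℤ) : ℤ)) = v := fun v => rfl
  simp only [Int.cast_id, hc, embed_sub, embed_smul, embed_rev, hρa, hρb, embed_letterVec,
    letterVec_rev, embed_neg, if_neg h1, if_neg h1.symm, if_neg h2', if_neg h3,
    if_neg (rev_ne_self _), if_true]
  funext i
  simp only [Pi.add_apply, Pi.sub_apply, Pi.smul_apply, Pi.neg_apply, smul_eq_mul]
  ring

/-! ### Consequences of permissibility -/

/-- Signed permutations preserve the ℓ¹ norm, the norm of `μ` is `1`, and the unit ball is convex.
-/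
theorem convOrbit_mu_subset (hn : 2 ≤ n) {x : Fin n → ℝ} (hx : x ∈ convOrbit (mu n)) :
    ∑ i, |x i| ≤ 1 := by
  have hconv : Convex ℝ {x : Fin n → ℝ | ∑ i, |x i| ≤ 1} := by
    intro x hx y hy s t hs ht hst
    change ∑ i, |s * x i + t * y i| ≤ 1
    calc ∑ i, |s * x i + t * y i| ≤ ∑ i, (s * |x i| + t * |y i|) := by
          refine Finset.sum_le_sum fun i _ => (abs_add_le _ _).trans (le_of_eq ?_)
          rw [abs_mul, abs_mul, abs_of_nonneg hs, abs_of_nonneg ht]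
      _ = s * ∑ i, |x i| + t * ∑ i, |y i| := by
          rw [Finset.sum_add_distrib, Finset.mul_sum, Finset.mul_sum]
      _ ≤ s * 1 + t * 1 := add_le_add (mul_le_mul_of_nonneg_left hx hs)
          (mul_le_mul_of_nonneg_left hy ht)
      _ = 1 := by rw [mul_one, mul_one, hst]
  refine convexHull_min ?_ hconv hx
  rintro _ ⟨σ, _, rfl⟩
  change ∑ i, |((permAct σ (mu n) i : ℤ) : ℝ)| ≤ 1
  have hmu : ∑ i, |mu n i| = 1 := by
    rw [Finset.sum_eq_single ⟨0, by omega⟩]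
    · simp [mu]
    · intro i _ hi
      have : (i : ℕ) ≠ 0 := fun h => hi (Fin.ext h)
      simp [mu, this]
    · simp
  have h : ∑ k, |embed (permAct σ (mu n)) k| = ∑ k, |embed (mu n) k| := by
    simp only [embed_permAct]
    exact Equiv.sum_comp (σ : Equiv.Perm (Fin (2 * n)))⁻¹ fun k => |embed (mu n) k|
  rw [sum_abs_embed, sum_abs_embed, hmu] at h
  have h' : ∑ i, |permAct σ (mu n) i| = 1 := by linarith
  exact_mod_cast h'.le

theorem sum_abs_le_one_of_mem_closure (hn : 2 ≤ n) {w : IwahoriWeyl n}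
    (hw : Permissible (mu n) w) {x : Fin n → ℝ} (hx : x ∈ closure (baseAlcove n)) :
    ∑ i, |(act w x - x) i| ≤ 1 := by
  have hcont : Continuous fun x : Fin n → ℝ => ∑ i, |(act w x - x) i| := by
    have hact : ∀ i, Continuous fun x : Fin n → ℝ => act w x i := by
      intro i
      unfold act permAct embed
      simp only [Pi.add_apply]
      split_ifs <;> fun_prop
    refine continuous_finsetSum _ fun i _ => ?_
    exact ((hact i).sub (continuous_apply i)).abs
  exact closure_minimal (fun y hy => convOrbit_mu_subset hn (hw.2 y hy))
    (isClosed_le hcont continuous_const) hx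

theorem Permissible.odd_transVec (hn : 2 ≤ n) {w : IwahoriWeyl n} (hw : Permissible (mu n) w) :
    ¬ Even (∑ i, transVec w i) := by
  have h := even_sum_transVec_mul (translation (mu n)) ((translation (mu n))⁻¹ * w)
  rw [mul_inv_cancel_left] at h
  rw [h]
  have hmu : ∑ i, transVec (translation (mu n)) i = 1 := by
    change ∑ i, mu n i = 1
    rw [Finset.sum_eq_single ⟨0, by omega⟩]
    · simp [mu]
    · intro i _ hi
      have : (i : ℕ) ≠ 0 := fun h => hi (Fin.ext h)
      simp [mu, this]
    · simp
  rw [hmu]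
  intro h'
  exact absurd (h'.2 hw.1.1) (by decide)

theorem Permissible.isEven {w : IwahoriWeyl n} {μ : Fin n → ℤ} (hw : Permissible μ w) :
    IsEven (linPart w) := by
  have h : linPart ((translation μ)⁻¹ * w) = linPart w := by
    have h1 : linPart (translation μ)⁻¹ = 1 := inv_one
    rw [linPart_mul, h1, one_mul]
  rw [← h]
  exact hw.1.2

/-- The displacement of the origin is the translation part: an integral vector of ℓ¹ norm at most
`1`, and nonzero because its entries have odd sum. -/
theorem Permissible.exists_letterVec (hn : 2 ≤ n) {w : IwahoriWeyl n}
    (hw : Permissible (mu n) w) : ∃ j : Fin (2 * n), transVec w = letterVec j := by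
  have hz : ∀ {R : Type} [CommRing R] (k : Fin (2 * n)), embed (0 : Fin n → R) k = 0 := by
    intro R _ k
    unfold embed
    split_ifs <;> simp
  have hsum : ∑ i, |transVec w i| ≤ 1 := by
    have h := sum_abs_le_one_of_mem_closure hn hw (x := 0)
      (mem_closure_baseAlcove hn fun j l _ _ => by simp [hz])
    have e : ∀ i, (act w 0 - 0) i = (transVec w i : ℝ) := by
      intro i
      simp [act, permAct, hz]
    simp only [e] at h
    exact_mod_cast h
  have hodd := hw.odd_transVec hn
  have hex : ∃ i, transVec w i ≠ 0 := by
    by_contra hcon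
    push Not at hcon
    exact hodd (by simp [hcon])
  obtain ⟨i, hi⟩ := hex
  have hrest : ∀ k, k ≠ i → transVec w k = 0 := by
    intro k hk
    have h1 := Finset.sum_le_sum_of_subset_of_nonneg (f := fun i => |transVec w i|)
      (Finset.subset_univ {i, k}) fun _ _ _ => abs_nonneg _
    rw [Finset.sum_pair hk.symm] at h1
    have h2 := Int.one_le_abs hi
    exact abs_nonpos_iff.1 (by linarith)
  have hvi : |transVec w i| = 1 := by
    have h1 := Finset.single_le_sum (f := fun i => |transVec w i|) (fun _ _ => abs_nonneg _)
      (Finset.mem_univ i)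
    exact le_antisymm (h1.trans hsum) (Int.one_le_abs hi)
  have hsingle : transVec w = Pi.single i (transVec w i) := by
    funext k
    by_cases hk : k = i
    · rw [hk, Pi.single_eq_same]
    · rw [Pi.single_eq_of_ne hk, hrest k hk]
  rcases (abs_eq zero_le_one).1 hvi with h | h
  · exact ⟨low i, by rw [hsingle, h, letterVec_low]⟩
  · exact ⟨Fin.rev (low i), by rw [hsingle, h, letterVec_rev, letterVec_low, Pi.single_neg]⟩

theorem sum_eq_sum_otherLetters (j : Fin (2 * n)) {h : Fin (2 * n) → ℤ}
    (heven : ∀ m, h (Fin.rev m) = h m) : ∑ m, h m = ∑ m ∈ otherLetters j, h m + 2 * h j := by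
  have e : otherLetters j = (Finset.univ.erase j).erase (Fin.rev j) := by
    ext m
    simp [mem_otherLetters, and_comm]
  rw [e, ← Finset.add_sum_erase _ h (Finset.mem_univ j), ← Finset.add_sum_erase _ h
    (Finset.mem_erase.2 ⟨rev_ne_self j, Finset.mem_univ (Fin.rev j)⟩), heven]
  ring

theorem Permissible.vertexBound (hn : 2 ≤ n) {w : IwahoriWeyl n}
    (hw : Permissible (mu n) w) {j : Fin (2 * n)} (hj : transVec w = letterVec j) {k : ℕ}
    (hk : k ≤ n) : VertexBound j (linPart w) k := by
  -- The factor `1/2` is what the affine inequalities require, since a root can take the value `2`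
  -- on `f_k`.
  have hmem : ((1 / 2 : ℝ) • fun i => (initVec n k i : ℝ)) ∈ closure (baseAlcove n) := by
    refine mem_closure_baseAlcove hn fun p q hpq _ => ?_
    rw [embed_smul, embed_smul, embed_intCast, embed_intCast]
    have h1 : 0 ≤ embed (initVec n k) p - embed (initVec n k) q ∧
        embed (initVec n k) p - embed (initVec n k) q ≤ 2 := by
      rw [Fin.lt_def] at hpq
      rw [embed_initVec hk, embed_initVec hk]
      split_ifs <;> omega
    have h2 : (0 : ℝ) ≤ (embed (initVec n k) p : ℤ) - (embed (initVec n k) q : ℤ) := by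
      exact_mod_cast h1.1
    have h3 : ((embed (initVec n k) p : ℤ) : ℝ) - (embed (initVec n k) q : ℤ) ≤ 2 := by
      exact_mod_cast h1.2
    constructor <;> linarith
  have h := sum_abs_le_one_of_mem_closure hn hw hmem
  set y : Fin n → ℤ := permAct (linPart w) (initVec n k) - initVec n k + (2 : ℤ) • letterVec j
    with hy
  have e : ∀ i, (act w ((1 / 2 : ℝ) • fun i => (initVec n k i : ℝ)) -
      (1 / 2 : ℝ) • fun i => (initVec n k i : ℝ)) i = (1 / 2) * (y i : ℝ) := by
    intro i
    rw [act, permAct_smul, hy, hj]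
    have : permAct (linPart w) (fun i => (initVec n k i : ℝ)) i =
        ((permAct (linPart w) (initVec n k) i : ℤ) : ℝ) := embed_intCast _ _
    simp only [Pi.add_apply, Pi.sub_apply, Pi.smul_apply, smul_eq_mul, this]
    push_cast
    ring
  simp only [e, abs_mul, ← Finset.mul_sum] at h
  rw [abs_of_pos (by norm_num : (0 : ℝ) < 1 / 2)] at h
  have h' : ∑ i, |y i| ≤ 2 := by
    have : ∑ i, |(y i : ℝ)| ≤ 2 := by linarith
    exact_mod_cast this
  have hlet := sum_abs_embed y
  rw [sum_eq_sum_otherLetters j (fun m => by rw [embed_rev, abs_neg])] at hlet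
  have hyj : embed y j = embed (permAct (linPart w) (initVec n k)) j - embed (initVec n k) j + 2 := by
    rw [hy, embed_add, embed_sub, embed_smul, embed_letterVec, if_pos rfl, if_neg (rev_ne_self j)]
    ring
  have hym : ∀ m ∈ otherLetters j, |embed y m| =
      |embed (permAct (linPart w) (initVec n k)) m - embed (initVec n k) m| := by
    intro m hm
    rw [mem_otherLetters] at hm
    rw [hy, embed_add, embed_sub, embed_smul, embed_letterVec, if_neg hm.1,
      if_neg fun e => hm.2 (by rw [← e, Fin.rev_rev]), sub_zero, mul_zero, add_zero]
  rw [Finset.sum_congr rfl hym, hyj] at hlet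
  unfold VertexBound
  have := le_abs_self (embed (permAct (linPart w) (initVec n k)) j - embed (initVec n k) j + 2)
  linarith

/-! ### Elements with a fixed translation part -/

/-- The element `t_ν σ`. -/
def ofParts (ν : Fin n → ℤ) (σ : starPerm n) : IwahoriWeyl n := ⟨Multiplicative.ofAdd ν, σ⟩

/-- The linear reflection sends `e_j` to `e_l`, and the translation by `e_j - e_l` brings it back;
the constant term `1` is chosen for this. -/
theorem affRefl_mul_ofParts {j l : Fin (2 * n)} (h1 : j ≠ l) (h2 : j ≠ Fin.rev l)
    (σ : starPerm n) : affRefl j l 1 * ofParts (letterVec j) σ =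
      ofParts (letterVec j) (weylRefl j l * σ) := by
  refine iwahoriWeyl_ext ?_ rfl
  rw [transVec_mul, transVec_affRefl, linPart_affRefl]
  change (1 : ℤ) • (letterVec j - letterVec l) + permAct (weylRefl j l) (letterVec j) = letterVec j
  rw [permAct_letterVec, weylRefl_apply h1 h2, if_pos rfl, one_smul, sub_add_cancel]

theorem rootValue_rho_one_neg {j l : Fin (2 * n)} (h1 : j ≠ l) (h2 : j ≠ Fin.rev l) :
    rootValue j l 1 (rho n) < 0 := by
  unfold rootValue
  rcases lt_or_gt_of_ne h1 with h | h
  · have := (rho_sub_bounds h h2).2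
    linarith
  · have := rho_sub_bounds h fun e => h2 (by rw [e, Fin.rev_rev])
    linarith

theorem rootValue_ofParts {j l : Fin (2 * n)} (hl : l ∈ otherLetters j) (σ : starPerm n) :
    rootValue j l 1 (scaledPoint (ofParts (letterVec j) σ)) =
      embed (rho n) ((σ : Equiv.Perm (Fin (2 * n)))⁻¹ j) -
        embed (rho n) ((σ : Equiv.Perm (Fin (2 * n)))⁻¹ l) := by
  rw [mem_otherLetters] at hl
  have ht : transVec (ofParts (letterVec j) σ) = letterVec j := rfl
  have hσ : linPart (ofParts (letterVec j) σ) = σ := rfl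
  rw [rootValue, embed_scaledPoint, embed_scaledPoint, ht, hσ, embed_letterVec, embed_letterVec,
    if_pos rfl, if_neg (rev_ne_self j), if_neg hl.1,
    if_neg fun e => hl.2 (by rw [← e, Fin.rev_rev])]
  ring

/-- The elements of the affine Weyl group attached to a fixed translation part and a fixed
element of the stabilizer of the base alcove are comparable if the linear part satisfies the
vertex conditions. -/
theorem coxeterBruhatLE_of_vertexBound (hn : 2 ≤ n) {j : Fin (2 * n)} {w₀ : IwahoriWeyl n}
    (hw₀ : scaledPoint w₀ = rho n)
    (hmem : ∀ σ : starPerm n, IsEven σ → ofParts (letterVec j) σ * w₀⁻¹ ∈ affineWeyl n)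
    (σ : starPerm n) (hσ : IsEven σ) (hV : ∀ k ≤ n, VertexBound j σ k)
    (h1 : IsEven (1 : starPerm n)) :
    CoxeterBruhatLE (simpleReflections n) ⟨_, hmem σ hσ⟩ ⟨_, hmem 1 h1⟩ := by
  classical
  let len : starPerm n → ℕ := fun σ =>
    if h : IsEven σ then wordLength (simpleReflections n) ⟨_, hmem σ h⟩ else 0
  by_contra hbad
  -- Among the finitely many counterexamples one of maximal length is taken. The step from
  -- `exists_step` makes it longer, so the result is no counterexample, and transitivity finishes.
  obtain ⟨τ, ⟨hτ, hVτ, hτbad⟩, hmax⟩ := Set.exists_max_image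
    {σ : starPerm n | ∃ hσ : IsEven σ, (∀ k ≤ n, VertexBound j σ k) ∧
      ¬ CoxeterBruhatLE (simpleReflections n) ⟨_, hmem σ hσ⟩ ⟨_, hmem 1 h1⟩} len
    (Set.toFinite _) ⟨σ, hσ, hV, hbad⟩
  have hne : τ ≠ 1 := by
    rintro rfl
    exact hτbad Relation.ReflTransGen.refl
  obtain ⟨l, hl, hlt, hV'⟩ := exists_step hτ hVτ hne
  have hl' := mem_otherLetters.1 hl
  have hjl : j ≠ Fin.rev l := fun e => hl'.2 (by rw [e, Fin.rev_rev])
  have heven : IsEven (weylRefl j l * τ) := isEven_mul (isEven_weylRefl hl'.1.symm) hτ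
  have hstep := coxeterBruhat_step hn ⟨_, hmem τ hτ⟩ hl'.1.symm hjl 1 (by
    rw [scaledPoint_mul_of_eq (scaledPoint_inv_of_eq hw₀), rootValue_ofParts hl]
    exact mul_pos_of_neg_of_neg (rootValue_rho_one_neg hl'.1.symm hjl) (by linarith))
  have heq : (⟨affRefl j l 1, affRefl_mem hl'.1.symm 1⟩ : affineWeyl n) * ⟨_, hmem τ hτ⟩ =
      ⟨_, hmem _ heven⟩ := by
    apply Subtype.ext
    rw [Subgroup.coe_mul, ← mul_assoc, affRefl_mul_ofParts hl'.1.symm hjl]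
  rw [heq] at hstep
  by_cases hle : CoxeterBruhatLE (simpleReflections n) ⟨_, hmem _ heven⟩ ⟨_, hmem 1 h1⟩
  · exact hτbad (hstep.1.trans hle)
  · have := hmax _ ⟨heven, hV', hle⟩
    simp only [len, dif_pos heven, dif_pos hτ] at this
    exact absurd hstep.2 (not_lt.2 this)

end OrthWeyl

/-! ### Comparison of a permissible element with its translation part -/

theorem mainTheorem3 (n : ℕ) (hn : 2 ≤ n) (w : OrthWeyl.IwahoriWeyl n)
    (hw : OrthWeyl.Permissible (OrthWeyl.mu n) w) :
    OrthWeyl.BruhatLE w (OrthWeyl.translation (OrthWeyl.transVec w)) := by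
  obtain ⟨j, hj⟩ := hw.exists_letterVec hn
  obtain ⟨w₀, hw₀, hw₀even, hw₀odd⟩ := OrthWeyl.exists_odd_stabilizer hn
  -- Both `t_{e_j} σ` and `w₀` have even linear part and odd translation part, so their quotient is
  -- in the affine Weyl group. One `w₀` thus serves as the `Ω` component for every even `σ`.
  have hmem : ∀ σ : OrthWeyl.starPerm n, OrthWeyl.IsEven σ →
      OrthWeyl.ofParts (OrthWeyl.letterVec j) σ * w₀⁻¹ ∈ OrthWeyl.affineWeyl n := by
    intro σ hσ
    refine ⟨?_, OrthWeyl.isEven_mul hσ (OrthWeyl.isEven_inv hw₀even)⟩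
    have h1 := OrthWeyl.even_sum_transVec_mul
      (OrthWeyl.ofParts (OrthWeyl.letterVec j) σ * w₀⁻¹) w₀
    rw [inv_mul_cancel_right] at h1
    have h2 : ¬ Even (∑ i, OrthWeyl.transVec (OrthWeyl.ofParts (OrthWeyl.letterVec j) σ) i) :=
      Int.not_even_iff_odd.2 (OrthWeyl.odd_sum_letterVec j)
    tauto
  have h1 : OrthWeyl.IsEven (1 : OrthWeyl.starPerm n) := Equiv.Perm.sign_one
  have hwparts : w = OrthWeyl.ofParts (OrthWeyl.letterVec j) (OrthWeyl.linPart w) :=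
    OrthWeyl.iwahoriWeyl_ext hj rfl
  have htparts : OrthWeyl.translation (OrthWeyl.transVec w) =
      OrthWeyl.ofParts (OrthWeyl.letterVec j) 1 := by
    rw [hj]; rfl
  refine ⟨⟨_, hmem _ hw.isEven⟩, ⟨_, hmem 1 h1⟩, w₀, OrthWeyl.mem_Omega_of_scaledPoint_eq hn hw₀,
    ?_, ?_, OrthWeyl.coxeterBruhatLE_of_vertexBound hn hw₀ hmem _ hw.isEven
      (fun k hk => hw.vertexBound hn hj hk) h1⟩
  · rw [inv_mul_cancel_right, ← hwparts]
  · rw [inv_mul_cancel_right, htparts]
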